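/- For $\mu\in\mathbb R$ and a smooth real-valued function $f$ on $\mathbb R_+=(0,+\infty)$ put $$\|f\|^2=\int_0^{+\infty}\left(x^{\mu+1}(f'')^2+(x^{\mu+1}+x^{\mu-1})(f')^2+x^{\mu-1}f^2\right)dx,$$ let $\mathcal E_\mu(\mathbb R_+)=\{f\in C^\infty(\mathbb R_+):\|f\|<+\infty\}$, and let $\bar{\mathcal E}_\mu(\mathbb R_+)$ be its Hilbert space completion with respect to $\|\cdot\|$, realised as a space of functions on $\mathbb R_+$ (modulo equality almost everywhere) with derivatives $f',f''$ in the corresponding weighted $L^2$ spaces. Suppose that $\mu\neq0$ and $\varepsilon$ are two reals with $\varepsilon\le\frac{\mu^2}{4}$, and let $b=\frac{\mu-\sqrt{\mu^2-4\varepsilon}}{2}$. For $f\in\bar{\mathcal E}_\mu(\mathbb R_+)$, the equality $$\left(\int_0^{+\infty}(f'')^2x^{\mu+1}dx\right)\left(\int_0^{+\infty}\left(x^2(f')^2-\varepsilon f^2\right)x^{\mu-1}dx\right)=\frac14\left(\sqrt{\mu^2-4\varepsilon}+1\right)^2\left(\int_0^{+\infty}(f')^2x^{\mu}dx\right)^2$$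 holds if and only if, for some $C\in\mathbb R$ and $\lambda>0$, $$f(x)=Ce^{-\lambda x}\,{}_1F_1(b,\mu,\lambda x)\quad\text{in the case }\mu>0,$$ or $$f(x)=C(\lambda x)^{1-\mu}e^{-\lambda x}\,{}_1F_1(b+1-\mu,2-\mu,\lambda x)\quad\text{in the case }\mu<0.$$ Moreover, if $\varepsilon<\frac{\mu^2}{4}$, then all these functions belong to $\mathcal E_\mu(\mathbb R_+)\subset\bar{\mathcal E}_\mu(\mathbb R_+)$. Here $${}_1F_1(a,c,x)=1+\sum_{k=1}^{+\infty}\frac{a(a+1)\cdots(a+k-1)}{c(c+1)\cdots(c+k-1)}\frac{x^k}{k!}$$ is Kummer's confluent hypergeometric function. -/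

import Mathlib

open MeasureTheory Set Filter Topology
open scoped ContDiff

/-- Kummer's confluent hypergeometric function
`₁F₁(a, c, x) = ∑ₖ a(a+1)⋯(a+k-1) / (c(c+1)⋯(c+k-1)) · xᵏ / k!`
(for real `c` that is not a non-positive integer; the series converges for every real `x`). -/
noncomputable def kummer (a c x : ℝ) : ℝ :=
  ∑' k : ℕ, (ascPochhammer ℝ k).eval a / (ascPochhammer ℝ k).eval c * (x ^ k / (k.factorial : ℝ))

/-- The square of the weighted Sobolev norm of the triple `(f, f', f'')` on `(0, ∞)`,
with values in `[0, ∞]`. -/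
noncomputable def sqNorm (μ : ℝ) (f f₁ f₂ : ℝ → ℝ) : ENNReal :=
  ∫⁻ x in Ioi (0 : ℝ), ENNReal.ofReal
    (x ^ (μ + 1) * f₂ x ^ 2 + (x ^ (μ + 1) + x ^ (μ - 1)) * f₁ x ^ 2 + x ^ (μ - 1) * f x ^ 2)

/-- The space `𝓔_μ` of smooth functions on `(0, ∞)` with finite norm. Only the values on
`(0, ∞)` matter. -/
def MemE (μ : ℝ) (φ : ℝ → ℝ) : Prop :=
  ContDiffOn ℝ ∞ φ (Ioi 0) ∧ sqNorm μ φ (deriv φ) (deriv (deriv φ)) < ⊤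

/-- The Hilbert space completion of `𝓔_μ`. The map `φ ↦ (φ, φ', φ'')` embeds `𝓔_μ`
isometrically into a (complete) product of weighted `L²` spaces on `(0, ∞)`; the completion is the
closure of its image. So `MemEbar μ f f₁ f₂` says that the (classes of the) measurable functions
`f, f₁, f₂` are the limit, in the norm, of a sequence from `𝓔_μ`: the function `f` belongs to the
completion and `f' = f₁`, `f'' = f₂` are its derivatives there. -/
def MemEbar (μ : ℝ) (f f₁ f₂ : ℝ → ℝ) : Prop :=
  AEStronglyMeasurable f (volume.restrict (Ioi 0)) ∧
  AEStronglyMeasurable f₁ (volume.restrict (Ioi 0)) ∧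
  AEStronglyMeasurable f₂ (volume.restrict (Ioi 0)) ∧
  ∃ φ : ℕ → ℝ → ℝ, (∀ n, MemE μ (φ n)) ∧
    Tendsto (fun n => sqNorm μ (fun x => f x - φ n x) (fun x => f₁ x - deriv (φ n) x)
      (fun x => f₂ x - deriv (deriv (φ n)) x)) atTop (𝓝 0)

/-- Equality in the interpolation inequality, for a function `f` with derivatives `f₁, f₂`. -/
def InterpolationEquality (μ ε : ℝ) (f f₁ f₂ : ℝ → ℝ) : Prop :=
  (∫ x in Ioi (0 : ℝ), f₂ x ^ 2 * x ^ (μ + 1)) *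
      (∫ x in Ioi (0 : ℝ), (x ^ 2 * f₁ x ^ 2 - ε * f x ^ 2) * x ^ (μ - 1)) =
    1 / 4 * (Real.sqrt (μ ^ 2 - 4 * ε) + 1) ^ 2 *
      (∫ x in Ioi (0 : ℝ), f₁ x ^ 2 * x ^ μ) ^ 2

/-! Put `s = μ - b`, the larger root of `(μ - s) s = ε`, so that `2s - μ = √(μ² - 4ε)`. For real `l`
consider the operator `L f = x f'' + (l x + μ) f' + l s f`. Expanding the integral of `x ^ (μ - 1)
(L f)²` and integrating the cross terms by parts leaves `A + l² B - l k D`, where `A`, `B`, `D` are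
the three integrals of the theorem and `k = √(μ² - 4ε) + 1` (`JetIdentities.integral_sq`). This
polynomial in `l` is nonnegative, so its discriminant is at most zero, which is the inequality `k²
D² ≤ 4 A B`. Equality with `D > 0` means that the polynomial vanishes at some `l > 0`, that is, `L f
= 0`; if `D = 0`, then `f = 0`.

The substitution `f = exp (-l x) u (l x)` turns `L f = 0` into Kummer's equation with parameters `b`
and `μ`, which gives one explicit solution for each sign of `μ`. The second solution is excluded at
the origin: finiteness of the norm forces `x ^ (μ / 2) f` and `x ^ (μ / 2) f'` to tend to zero,
hence so does the weighted Wronskian with the explicit solution; being constant, it vanishes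
(`IsKummerSol.wronskian_eq_zero`).

For elements of the completion, the identities pass to the limit in `L²`, and a representative with
absolutely continuous derivative makes the differential equation classical. If `ε < μ² / 4`,
solutions decay at infinity like `x ^ (-p)` with some `p > μ / 2` (`IsKummerSol.decay`), so the norm
is finite. -/

/-- A function `k` on `(0, ∞)` for which `k / x` and `k'` are integrable vanishes at `0`,
and the integral of `k'` is zero. -/
theorem integral_deriv_eq_zero_of_integrable_div {k k' : ℝ → ℝ}
    (hk : ∀ x, 0 < x → HasDerivAt k (k' x) x)
    (h1 : IntegrableOn (fun x => k x / x) (Ioi 0)) (h2 : IntegrableOn k' (Ioi 0)) :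
    (∫ x in Ioi (0 : ℝ), k' x) = 0 ∧ Tendsto k (𝓝[>] 0) (𝓝 0) := by
  -- With `x = exp t` the measure `dx / x` becomes `dt`, so `k ∘ exp` and its derivative are both
  -- integrable over the whole line; such a function vanishes at both ends.
  have himg : Real.exp '' univ = Ioi 0 := by rw [image_univ, Real.range_exp]
  have hd : ∀ x ∈ (univ : Set ℝ), HasDerivWithinAt Real.exp (Real.exp x) univ x :=
    fun x _ => (Real.hasDerivAt_exp x).hasDerivWithinAt
  have hinj : InjOn Real.exp univ := Real.exp_injective.injOn
  have key : ∀ t, HasDerivAt (fun t => k (Real.exp t)) (Real.exp t * k' (Real.exp t)) t := by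
    intro t
    have := (hk _ (Real.exp_pos t)).comp t (Real.hasDerivAt_exp t)
    rwa [mul_comm] at this
  have i1 : Integrable (fun t => k (Real.exp t)) := by
    rw [← himg, integrableOn_image_iff_integrableOn_abs_deriv_smul MeasurableSet.univ hd hinj,
      integrableOn_univ] at h1
    refine h1.congr (Eventually.of_forall fun t => ?_)
    have := (Real.exp_pos t).ne'
    simp only [abs_of_pos (Real.exp_pos t), smul_eq_mul]
    field_simp
  have i2 : Integrable (fun t => Real.exp t * k' (Real.exp t)) := by
    rw [← himg, integrableOn_image_iff_integrableOn_abs_deriv_smul MeasurableSet.univ hd hinj,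
      integrableOn_univ] at h2
    refine h2.congr (Eventually.of_forall fun t => ?_)
    simp only [abs_of_pos (Real.exp_pos t), smul_eq_mul]
  refine ⟨?_, ?_⟩
  · rw [← himg, integral_image_eq_integral_abs_deriv_smul MeasurableSet.univ hd hinj,
      setIntegral_univ]
    simp only [abs_of_pos (Real.exp_pos _), smul_eq_mul]
    exact integral_eq_zero_of_hasDerivAt_of_integrable key i2 i1
  · have := tendsto_zero_of_hasDerivAt_of_integrableOn_Iic (a := 0)
      (fun x _ => key x) i2.integrableOn i1.integrableOn
    have h3 := this.comp Real.tendsto_log_nhdsGT_zero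
    refine h3.congr' ?_
    filter_upwards [self_mem_nhdsWithin] with x hx
    simp [Real.exp_log hx]

/-! ### Weighted `L²` formulation of the norm -/

/-- Lebesgue measure on `(0, ∞)`. -/
noncomputable abbrev volPos : Measure ℝ := volume.restrict (Ioi 0)

/-- The function `f` multiplied by the square root of the weight `x ^ r`. -/
noncomputable def wt (r : ℝ) (f : ℝ → ℝ) : ℝ → ℝ := fun x => x ^ (r / 2) * f x

theorem wt_mul_wt {r t q : ℝ} (h : r + t = 2 * q) (f g : ℝ → ℝ) {x : ℝ} (hx : 0 < x) :
    wt r f x * wt t g x = x ^ q * (f x * g x) := by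
  have : x ^ q = x ^ (r / 2) * x ^ (t / 2) := by
    rw [← Real.rpow_add hx]; congr 1; linarith
  rw [this, wt, wt]; ring

theorem wt_sub (r : ℝ) (f g : ℝ → ℝ) (x : ℝ) : wt r (fun x => f x - g x) x = wt r f x - wt r g x := by
  simp only [wt]; ring

theorem measurable_rpow_half (r : ℝ) : AEStronglyMeasurable (fun x : ℝ => x ^ (r / 2)) volPos := by
  refine ContinuousOn.aestronglyMeasurable ?_ measurableSet_Ioi
  intro x hx
  exact (Real.continuousAt_rpow_const _ _ (Or.inl (ne_of_gt hx))).continuousWithinAt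

theorem MeasureTheory.AEStronglyMeasurable.wt {r : ℝ} {f : ℝ → ℝ}
    (hf : AEStronglyMeasurable f volPos) : AEStronglyMeasurable (wt r f) volPos :=
  (measurable_rpow_half r).mul hf

/-- All the weighted functions that enter the norm are square integrable. -/
structure JetMemLp (μ : ℝ) (f f₁ f₂ : ℝ → ℝ) : Prop where
  memX : MemLp (wt (μ + 1) f₂) 2 volPos
  memY : MemLp (wt (μ + 1) f₁) 2 volPos
  memZ : MemLp (wt (μ - 1) f₁) 2 volPos
  memW : MemLp (wt (μ - 1) f) 2 volPos

theorem sqNorm_integrand {μ : ℝ} (f f₁ f₂ : ℝ → ℝ) {x : ℝ} (hx : 0 < x) :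
    x ^ (μ + 1) * f₂ x ^ 2 + (x ^ (μ + 1) + x ^ (μ - 1)) * f₁ x ^ 2 + x ^ (μ - 1) * f x ^ 2 =
    wt (μ + 1) f₂ x ^ 2 + wt (μ + 1) f₁ x ^ 2 + wt (μ - 1) f₁ x ^ 2 + wt (μ - 1) f x ^ 2 := by
  simp only [pow_two (wt _ _ x)]
  rw [wt_mul_wt (q := μ + 1) (by ring) _ _ hx, wt_mul_wt (q := μ + 1) (by ring) _ _ hx,
    wt_mul_wt (q := μ - 1) (by ring) _ _ hx, wt_mul_wt (q := μ - 1) (by ring) _ _ hx]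
  ring

theorem eLpNorm_two_le_of_sq_le {h : ℝ → ℝ} {μ : ℝ} {f f₁ f₂ : ℝ → ℝ}
    (H : ∀ x, 0 < x → h x ^ 2 ≤ wt (μ + 1) f₂ x ^ 2 + wt (μ + 1) f₁ x ^ 2 + wt (μ - 1) f₁ x ^ 2
      + wt (μ - 1) f x ^ 2) :
    eLpNorm h 2 volPos ≤ sqNorm μ f f₁ f₂ ^ (1 / 2 : ℝ) := by
  rw [eLpNorm_eq_lintegral_rpow_enorm_toReal (by norm_num) (by norm_num)]
  simp only [ENNReal.toReal_ofNat]
  refine ENNReal.rpow_le_rpow ?_ (by norm_num)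
  refine setLIntegral_mono' measurableSet_Ioi fun x hx => ?_
  rw [sqNorm_integrand f f₁ f₂ hx, ← ofReal_norm,
    ENNReal.ofReal_rpow_of_nonneg (norm_nonneg _) (by norm_num)]
  refine ENNReal.ofReal_le_ofReal ?_
  simpa using H x hx

theorem eLpNorm_jet_le (μ : ℝ) (f f₁ f₂ : ℝ → ℝ) :
    eLpNorm (wt (μ + 1) f₂) 2 volPos ≤ sqNorm μ f f₁ f₂ ^ (1 / 2 : ℝ) ∧
    eLpNorm (wt (μ + 1) f₁) 2 volPos ≤ sqNorm μ f f₁ f₂ ^ (1 / 2 : ℝ) ∧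
    eLpNorm (wt (μ - 1) f₁) 2 volPos ≤ sqNorm μ f f₁ f₂ ^ (1 / 2 : ℝ) ∧
    eLpNorm (wt (μ - 1) f) 2 volPos ≤ sqNorm μ f f₁ f₂ ^ (1 / 2 : ℝ) := by
  refine ⟨?_, ?_, ?_, ?_⟩ <;> refine eLpNorm_two_le_of_sq_le fun x _ => ?_ <;>
  linarith [sq_nonneg (wt (μ + 1) f₂ x), sq_nonneg (wt (μ + 1) f₁ x), sq_nonneg (wt (μ - 1) f₁ x),
    sq_nonneg (wt (μ - 1) f x)]

theorem JetMemLp.of_sqNorm {μ : ℝ} {f f₁ f₂ : ℝ → ℝ} (hf : AEStronglyMeasurable f volPos)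
    (hf₁ : AEStronglyMeasurable f₁ volPos) (hf₂ : AEStronglyMeasurable f₂ volPos)
    (h : sqNorm μ f f₁ f₂ < ⊤) : JetMemLp μ f f₁ f₂ := by
  obtain ⟨h1, h2, h3, h4⟩ := eLpNorm_jet_le μ f f₁ f₂
  have ht : sqNorm μ f f₁ f₂ ^ (1 / 2 : ℝ) < ⊤ := ENNReal.rpow_lt_top_of_nonneg (by norm_num) h.ne
  exact ⟨⟨hf₂.wt, h1.trans_lt ht⟩, ⟨hf₁.wt, h2.trans_lt ht⟩, ⟨hf₁.wt, h3.trans_lt ht⟩,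
    ⟨hf.wt, h4.trans_lt ht⟩⟩

/-- This is the continuity of the inner product of `L²`; it carries every identity and primitive
from smooth functions to the completion. -/
theorem tendsto_integral_mul_of_eLpNorm {ι : Type*} {l : Filter ι} {X Y : ℝ → ℝ} {Xn Yn : ι → ℝ → ℝ}
    {ν : Measure ℝ} (hX : MemLp X 2 ν) (hY : MemLp Y 2 ν) (hXn : ∀ n, MemLp (Xn n) 2 ν)
    (hYn : ∀ n, MemLp (Yn n) 2 ν) (hx : Tendsto (fun n => eLpNorm (Xn n - X) 2 ν) l (𝓝 0))
    (hy : Tendsto (fun n => eLpNorm (Yn n - Y) 2 ν) l (𝓝 0)) :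
    Tendsto (fun n => ∫ x, Xn n x * Yn n x ∂ν) l (𝓝 (∫ x, X x * Y x ∂ν)) := by
  have tX : Tendsto (fun n => (hXn n).toLp) l (𝓝 hX.toLp) :=
    (Lp.tendsto_Lp_iff_tendsto_eLpNorm'' Xn hXn X hX).2 hx
  have tY : Tendsto (fun n => (hYn n).toLp) l (𝓝 hY.toLp) :=
    (Lp.tendsto_Lp_iff_tendsto_eLpNorm'' Yn hYn Y hY).2 hy
  have key : ∀ {P Q : ℝ → ℝ} (hP : MemLp P 2 ν) (hQ : MemLp Q 2 ν),
      ∫ x, P x * Q x ∂ν = inner ℝ hP.toLp hQ.toLp := by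
    intro P Q hP hQ
    rw [L2.inner_def]
    refine integral_congr_ae ?_
    filter_upwards [hP.coeFn_toLp, hQ.coeFn_toLp] with x h1 h2
    rw [h1, h2]; simp [mul_comm]
  simp_rw [key hX hY, fun n => key (hXn n) (hYn n)]
  exact tX.inner tY

theorem MemE.hasDerivAt {μ : ℝ} {φ : ℝ → ℝ} (h : MemE μ φ) {x : ℝ} (hx : 0 < x) :
    HasDerivAt φ (deriv φ x) x :=
  ((h.1.differentiableOn (by simp)).differentiableAt (Ioi_mem_nhds hx)).hasDerivAt

theorem MemE.contDiffOn_deriv {μ : ℝ} {φ : ℝ → ℝ} (h : MemE μ φ) :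
    ContDiffOn ℝ ∞ (deriv φ) (Ioi 0) :=
  ((contDiffOn_infty_iff_deriv_of_isOpen isOpen_Ioi).1 h.1).2

theorem MemE.contDiffOn_deriv₂ {μ : ℝ} {φ : ℝ → ℝ} (h : MemE μ φ) :
    ContDiffOn ℝ ∞ (deriv (deriv φ)) (Ioi 0) :=
  ((contDiffOn_infty_iff_deriv_of_isOpen isOpen_Ioi).1 h.contDiffOn_deriv).2

theorem MemE.hasDerivAt_deriv {μ : ℝ} {φ : ℝ → ℝ} (h : MemE μ φ) {x : ℝ} (hx : 0 < x) :
    HasDerivAt (deriv φ) (deriv (deriv φ) x) x :=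
  ((h.contDiffOn_deriv.differentiableOn (by simp)).differentiableAt (Ioi_mem_nhds hx)).hasDerivAt

theorem MemE.jetMemLp {μ : ℝ} {φ : ℝ → ℝ} (h : MemE μ φ) :
    JetMemLp μ φ (deriv φ) (deriv (deriv φ)) :=
  .of_sqNorm (h.1.continuousOn.aestronglyMeasurable measurableSet_Ioi)
    (h.contDiffOn_deriv.continuousOn.aestronglyMeasurable measurableSet_Ioi)
    (h.contDiffOn_deriv₂.continuousOn.aestronglyMeasurable measurableSet_Ioi) h.2

/-- The approximating sequence of an element of the completion, in terms of `L²` convergence. -/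
theorem MemEbar.exists_seq {μ : ℝ} {f f₁ f₂ : ℝ → ℝ} (h : MemEbar μ f f₁ f₂) :
    JetMemLp μ f f₁ f₂ ∧ ∃ φ : ℕ → ℝ → ℝ, (∀ n, MemE μ (φ n)) ∧
      Tendsto (fun n => eLpNorm (wt (μ + 1) (deriv (deriv (φ n))) - wt (μ + 1) f₂) 2 volPos)
        atTop (𝓝 0) ∧
      Tendsto (fun n => eLpNorm (wt (μ + 1) (deriv (φ n)) - wt (μ + 1) f₁) 2 volPos)
        atTop (𝓝 0) ∧
      Tendsto (fun n => eLpNorm (wt (μ - 1) (deriv (φ n)) - wt (μ - 1) f₁) 2 volPos)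
        atTop (𝓝 0) ∧
      Tendsto (fun n => eLpNorm (wt (μ - 1) (φ n) - wt (μ - 1) f) 2 volPos) atTop (𝓝 0) := by
  obtain ⟨hf, hf₁, hf₂, φ, hφ, ht⟩ := h
  have m0 : ∀ n, AEStronglyMeasurable (φ n) volPos := fun n =>
    (hφ n).1.continuousOn.aestronglyMeasurable measurableSet_Ioi
  have m1 : ∀ n, AEStronglyMeasurable (deriv (φ n)) volPos := fun n =>
    (hφ n).contDiffOn_deriv.continuousOn.aestronglyMeasurable measurableSet_Ioi
  have m2 : ∀ n, AEStronglyMeasurable (deriv (deriv (φ n))) volPos := fun n =>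
    (hφ n).contDiffOn_deriv₂.continuousOn.aestronglyMeasurable measurableSet_Ioi
  have hs : ∀ (r : ℝ) (u v : ℝ → ℝ), wt r (fun x => u x - v x) = wt r u - wt r v := fun r u v => by
    funext x; exact wt_sub r u v x
  refine ⟨?_, φ, hφ, ?_⟩
  · obtain ⟨n, hn⟩ := (ht.eventually (gt_mem_nhds ENNReal.zero_lt_top)).exists
    have J := JetMemLp.of_sqNorm (hf.sub (m0 n)) (hf₁.sub (m1 n)) (hf₂.sub (m2 n)) hn
    have K := (hφ n).jetMemLp
    have aux : ∀ (r : ℝ) (u v : ℝ → ℝ), MemLp (wt r (u - v)) 2 volPos → MemLp (wt r v) 2 volPos →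
        MemLp (wt r u) 2 volPos := by
      intro r u v h1 h2
      have h3 := h1.add h2
      rwa [show u - v = fun x => u x - v x from rfl, hs, sub_add_cancel] at h3
    exact ⟨aux _ _ _ J.memX K.memX, aux _ _ _ J.memY K.memY, aux _ _ _ J.memZ K.memZ,
      aux _ _ _ J.memW K.memW⟩
  · have ht' : Tendsto (fun n => sqNorm μ (fun x => f x - φ n x) (fun x => f₁ x - deriv (φ n) x)
        (fun x => f₂ x - deriv (deriv (φ n)) x) ^ (1 / 2 : ℝ)) atTop (𝓝 0) := by
      have := (ENNReal.continuous_rpow_const (y := (1 / 2 : ℝ))).tendsto 0 |>.comp ht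
      simpa [Function.comp_def] using this
    have aux : ∀ (r : ℝ) (u : ℝ → ℝ) (v : ℕ → ℝ → ℝ),
        (∀ n, eLpNorm (wt r (fun x => u x - v n x)) 2 volPos ≤ sqNorm μ (fun x => f x - φ n x)
          (fun x => f₁ x - deriv (φ n) x) (fun x => f₂ x - deriv (deriv (φ n)) x) ^ (1 / 2 : ℝ)) →
        Tendsto (fun n => eLpNorm (wt r (v n) - wt r u) 2 volPos) atTop (𝓝 0) := by
      intro r u v hle
      refine tendsto_of_tendsto_of_tendsto_of_le_of_le tendsto_const_nhds ht' (fun _ => zero_le)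
        (fun n => ?_)
      have := hle n
      rwa [hs, eLpNorm_sub_comm] at this
    have E := fun n => eLpNorm_jet_le μ (fun x => f x - φ n x)
          (fun x => f₁ x - deriv (φ n) x) (fun x => f₂ x - deriv (deriv (φ n)) x)
    exact ⟨aux _ _ _ fun n => (E n).1, aux _ _ _ fun n => (E n).2.1,
      aux _ _ _ fun n => (E n).2.2.1, aux _ _ _ fun n => (E n).2.2.2⟩

/-! ### Integration by parts and the quadratic polynomial -/

/-- The relations between the integrals of products of weighted derivatives obtained by
integrating by parts. -/
structure JetIdentities (μ : ℝ) (f f₁ f₂ : ℝ → ℝ) : Prop where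
  xy : 2 * ∫ x in Ioi (0 : ℝ), wt (μ + 1) f₂ x * wt (μ + 1) f₁ x =
    -(μ + 1) * ∫ x in Ioi (0 : ℝ), wt (μ + 1) f₁ x * wt (μ - 1) f₁ x
  xz : 2 * ∫ x in Ioi (0 : ℝ), wt (μ + 1) f₂ x * wt (μ - 1) f₁ x =
    -μ * ∫ x in Ioi (0 : ℝ), wt (μ - 1) f₁ x * wt (μ - 1) f₁ x
  xw : ∫ x in Ioi (0 : ℝ), wt (μ + 1) f₂ x * wt (μ - 1) f x =
    -(∫ x in Ioi (0 : ℝ), wt (μ + 1) f₁ x * wt (μ - 1) f₁ x)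
      - μ * ∫ x in Ioi (0 : ℝ), wt (μ - 1) f₁ x * wt (μ - 1) f x
  yw : 2 * ∫ x in Ioi (0 : ℝ), wt (μ + 1) f₁ x * wt (μ - 1) f x =
    -μ * ∫ x in Ioi (0 : ℝ), wt (μ - 1) f x * wt (μ - 1) f x

/-- Integration by parts for the product `x ^ q * u * v`. -/
theorem integral_by_parts_rpow {q : ℝ} {u u' v v' : ℝ → ℝ} {P Q : ℝ → ℝ}
    (hu : ∀ x, 0 < x → HasDerivAt u (u' x) x) (hv : ∀ x, 0 < x → HasDerivAt v (v' x) x)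
    (hP : ∀ x, 0 < x → P x = x ^ (q - 1) * (u x * v x))
    (hQ : ∀ x, 0 < x → Q x = x ^ q * (u' x * v x + u x * v' x))
    (iP : Integrable P volPos) (iQ : Integrable Q volPos) :
    (∫ x in Ioi (0 : ℝ), Q x) = -q * (∫ x in Ioi (0 : ℝ), P x) ∧
      Tendsto (fun x => x ^ q * (u x * v x)) (𝓝[>] 0) (𝓝 0) := by
  have hd : ∀ x, 0 < x → HasDerivAt (fun x => x ^ q * (u x * v x)) (q * P x + Q x) x := by
    intro x hx
    have := (Real.hasDerivAt_rpow_const (p := q) (Or.inl hx.ne')).mul ((hu x hx).mul (hv x hx))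
    refine this.congr_deriv ?_
    rw [hP x hx, hQ x hx]
    simp only [Pi.mul_apply]
    ring
  have i1 : IntegrableOn (fun x => x ^ q * (u x * v x) / x) (Ioi 0) := by
    refine Integrable.congr iP ?_
    filter_upwards [ae_restrict_mem measurableSet_Ioi] with x hx
    rw [hP x hx, Real.rpow_sub_one (ne_of_gt hx)]
    ring
  obtain ⟨h1, h2⟩ := integral_deriv_eq_zero_of_integrable_div hd i1 ((iP.const_mul q).add iQ)
  rw [integral_add (iP.const_mul q) iQ, integral_const_mul] at h1
  exact ⟨by linarith, h2⟩

/-- The products differentiated are `x ^ (μ + 1) G²`, `x ^ μ G²`, `x ^ μ G F` and `x ^ μ F²`. Every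
integrability condition is that of a product of two square integrable functions. The two limits at
`0` are by-products that later exclude the singular solution. -/
theorem JetMemLp.identities {μ : ℝ} {F G H : ℝ → ℝ} (J : JetMemLp μ F G H)
    (hF : ∀ x, 0 < x → HasDerivAt F (G x) x) (hG : ∀ x, 0 < x → HasDerivAt G (H x) x) :
    JetIdentities μ F G H ∧ Tendsto (fun x => x ^ μ * (F x * F x)) (𝓝[>] 0) (𝓝 0) ∧
      Tendsto (fun x => x ^ μ * (G x * G x)) (𝓝[>] 0) (𝓝 0) := by
  have XY : Integrable (fun x => wt (μ + 1) H x * wt (μ + 1) G x) volPos := J.memX.integrable_mul J.memY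
  have XZ : Integrable (fun x => wt (μ + 1) H x * wt (μ - 1) G x) volPos := J.memX.integrable_mul J.memZ
  have XW : Integrable (fun x => wt (μ + 1) H x * wt (μ - 1) F x) volPos := J.memX.integrable_mul J.memW
  have YZ : Integrable (fun x => wt (μ + 1) G x * wt (μ - 1) G x) volPos := J.memY.integrable_mul J.memZ
  have YW : Integrable (fun x => wt (μ + 1) G x * wt (μ - 1) F x) volPos := J.memY.integrable_mul J.memW
  have ZW : Integrable (fun x => wt (μ - 1) G x * wt (μ - 1) F x) volPos := J.memZ.integrable_mul J.memW
  have ZZ : Integrable (fun x => wt (μ - 1) G x * wt (μ - 1) G x) volPos := J.memZ.integrable_mul J.memZ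
  have WW : Integrable (fun x => wt (μ - 1) F x * wt (μ - 1) F x) volPos := J.memW.integrable_mul J.memW
  have a1 := integral_by_parts_rpow (q := μ + 1) hG hG
    (fun x hx => wt_mul_wt (r := μ + 1) (t := μ - 1) (by ring) G G hx)
    (Q := fun x => 2 * (wt (μ + 1) H x * wt (μ + 1) G x))
    (fun x hx => by rw [wt_mul_wt (q := μ + 1) (by ring) _ _ hx]; ring) YZ (XY.const_mul 2)
  have a2 := integral_by_parts_rpow (q := μ) hG hG
    (fun x hx => wt_mul_wt (r := μ - 1) (t := μ - 1) (by ring) G G hx)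
    (Q := fun x => 2 * (wt (μ + 1) H x * wt (μ - 1) G x))
    (fun x hx => by rw [wt_mul_wt (q := μ) (by ring) _ _ hx]; ring) ZZ (XZ.const_mul 2)
  have a3 := integral_by_parts_rpow (q := μ) hG hF
    (fun x hx => wt_mul_wt (r := μ - 1) (t := μ - 1) (by ring) G F hx)
    (Q := fun x => wt (μ + 1) H x * wt (μ - 1) F x + wt (μ + 1) G x * wt (μ - 1) G x)
    (fun x hx => by
      rw [wt_mul_wt (q := μ) (by ring) _ _ hx, wt_mul_wt (q := μ) (by ring) _ _ hx]; ring)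
    ZW (XW.add YZ)
  have a4 := integral_by_parts_rpow (q := μ) hF hF
    (fun x hx => wt_mul_wt (r := μ - 1) (t := μ - 1) (by ring) F F hx)
    (Q := fun x => 2 * (wt (μ + 1) G x * wt (μ - 1) F x))
    (fun x hx => by rw [wt_mul_wt (q := μ) (by ring) _ _ hx]; ring) WW (YW.const_mul 2)
  rw [integral_const_mul] at a1 a2 a4
  rw [integral_add XW YZ] at a3
  exact ⟨⟨a1.1, a2.1, by linarith [a3.1], a4.1⟩, a4.2, a2.2⟩

theorem MemEbar.jetMemLp {μ : ℝ} {f f₁ f₂ : ℝ → ℝ} (h : MemEbar μ f f₁ f₂) :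
    JetMemLp μ f f₁ f₂ := h.exists_seq.1

theorem MemEbar.jetIdentities {μ : ℝ} {f f₁ f₂ : ℝ → ℝ} (h : MemEbar μ f f₁ f₂) :
    JetIdentities μ f f₁ f₂ := by
  obtain ⟨J, φ, hφ, tX, tY, tZ, tW⟩ := h.exists_seq
  have K := fun n => (hφ n).jetMemLp
  have I := fun n => ((K n).identities (fun x hx => (hφ n).hasDerivAt hx)
    (fun x hx => (hφ n).hasDerivAt_deriv hx)).1
  have XY := tendsto_integral_mul_of_eLpNorm J.memX J.memY (fun n => (K n).memX) (fun n => (K n).memY) tX tY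
  have XZ := tendsto_integral_mul_of_eLpNorm J.memX J.memZ (fun n => (K n).memX) (fun n => (K n).memZ) tX tZ
  have XW := tendsto_integral_mul_of_eLpNorm J.memX J.memW (fun n => (K n).memX) (fun n => (K n).memW) tX tW
  have YZ := tendsto_integral_mul_of_eLpNorm J.memY J.memZ (fun n => (K n).memY) (fun n => (K n).memZ) tY tZ
  have YW := tendsto_integral_mul_of_eLpNorm J.memY J.memW (fun n => (K n).memY) (fun n => (K n).memW) tY tW
  have ZW := tendsto_integral_mul_of_eLpNorm J.memZ J.memW (fun n => (K n).memZ) (fun n => (K n).memW) tZ tW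
  have ZZ := tendsto_integral_mul_of_eLpNorm J.memZ J.memZ (fun n => (K n).memZ) (fun n => (K n).memZ) tZ tZ
  have WW := tendsto_integral_mul_of_eLpNorm J.memW J.memW (fun n => (K n).memW) (fun n => (K n).memW) tW tW
  refine ⟨?_, ?_, ?_, ?_⟩
  · exact tendsto_nhds_unique (XY.const_mul 2) ((YZ.const_mul _).congr fun n => (I n).xy.symm)
  · exact tendsto_nhds_unique (XZ.const_mul 2) ((ZZ.const_mul _).congr fun n => (I n).xz.symm)
  · exact tendsto_nhds_unique XW ((YZ.neg.sub (ZW.const_mul _)).congr fun n => (I n).xw.symm)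
  · exact tendsto_nhds_unique (YW.const_mul 2) ((WW.const_mul _).congr fun n => (I n).yw.symm)

theorem integral_add_mul_mul {ν : Measure ℝ} {P Q R : ℝ → ℝ} (hP : MemLp P 2 ν) (hQ : MemLp Q 2 ν)
    (hR : MemLp R 2 ν) (c : ℝ) :
    ∫ x, (P x + c * Q x) * R x ∂ν = (∫ x, P x * R x ∂ν) + c * ∫ x, Q x * R x ∂ν := by
  have h1 : Integrable (fun x => P x * R x) ν := hP.integrable_mul hR
  have h2 : Integrable (fun x => Q x * R x) ν := hQ.integrable_mul hR
  rw [← integral_const_mul, ← integral_add h1 (h2.const_mul c)]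
  congr 1; funext x; ring

/-- The integral of the square of the Kummer operator. -/
theorem JetIdentities.integral_sq {μ : ℝ} {f f₁ f₂ : ℝ → ℝ} (I : JetIdentities μ f f₁ f₂)
    (J : JetMemLp μ f f₁ f₂) (s l : ℝ) :
    ∫ x in Ioi (0 : ℝ), (wt (μ + 1) f₂ x + l * wt (μ + 1) f₁ x + μ * wt (μ - 1) f₁ x
        + l * s * wt (μ - 1) f x) ^ 2 =
      (∫ x in Ioi (0 : ℝ), wt (μ + 1) f₂ x * wt (μ + 1) f₂ x) +
      l ^ 2 * ((∫ x in Ioi (0 : ℝ), wt (μ + 1) f₁ x * wt (μ + 1) f₁ x)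
        - (μ - s) * s * ∫ x in Ioi (0 : ℝ), wt (μ - 1) f x * wt (μ - 1) f x)
      - l * (2 * s - μ + 1) * ∫ x in Ioi (0 : ℝ), wt (μ + 1) f₁ x * wt (μ - 1) f₁ x := by
  obtain ⟨i1, i2, i3, i4⟩ := I
  obtain ⟨hX, hY, hZ, hW⟩ := J
  set X := wt (μ + 1) f₂
  set Y := wt (μ + 1) f₁
  set Z := wt (μ - 1) f₁
  set W := wt (μ - 1) f
  have hXY : MemLp (fun x => X x + l * Y x) 2 volPos := hX.add (hY.const_mul l)
  have hXYZ : MemLp (fun x => X x + l * Y x + μ * Z x) 2 volPos := hXY.add (hZ.const_mul μ)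
  have hL : MemLp (fun x => X x + l * Y x + μ * Z x + l * s * W x) 2 volPos :=
    hXYZ.add (hW.const_mul (l * s))
  have expand : ∀ R : ℝ → ℝ, MemLp R 2 volPos →
      ∫ x, (X x + l * Y x + μ * Z x + l * s * W x) * R x ∂volPos = (∫ x, X x * R x ∂volPos)
        + l * (∫ x, Y x * R x ∂volPos) + μ * (∫ x, Z x * R x ∂volPos)
        + l * s * ∫ x, W x * R x ∂volPos := by
    intro R hR
    rw [integral_add_mul_mul hXYZ hW hR, integral_add_mul_mul hXY hZ hR,
      integral_add_mul_mul hX hY hR]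
  have comm : ∀ P Q : ℝ → ℝ, ∫ x, P x * Q x ∂volPos = ∫ x, Q x * P x ∂volPos := fun P Q => by
    simp_rw [mul_comm]
  simp_rw [pow_two (_ + _ : ℝ)]
  rw [expand _ hL, comm X _, comm Y _, comm Z _, comm W _, expand _ hX, expand _ hY, expand _ hZ,
    expand _ hW, comm Y X, comm Z X, comm W X, comm Z Y, comm W Y, comm W Z, i3]
  -- The terms in `Z²` and `Z W` cancel. The `Y Z` terms add up to `-l (μ + 1) - 2 l s + 2 l μ = -l
  -- (2 s - μ + 1)`, and the `W²` terms to `l² s² - l² s μ`.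
  linear_combination l * i1 + μ * i2 + l ^ 2 * s * i4

/-! ### Regular representatives of elements of the completion -/

theorem memLp_rpow_Ioc (q : ℝ) {x y : ℝ} (hx : 0 < x) :
    MemLp (fun z : ℝ => z ^ q) 2 (volume.restrict (Ioc x y)) := by
  have hc : ContinuousOn (fun z : ℝ => z ^ q) (Icc x y) := fun z hz =>
    (Real.continuousAt_rpow_const _ _ (Or.inl (hx.trans_le hz.1).ne')).continuousWithinAt
  obtain ⟨C, hC⟩ := isCompact_Icc.exists_bound_of_continuousOn hc
  refine MemLp.of_bound ((hc.mono Ioc_subset_Icc_self).aestronglyMeasurable measurableSet_Ioc) C ?_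
  filter_upwards [ae_restrict_mem measurableSet_Ioc] with z hz
  exact hC z (Ioc_subset_Icc_self hz)

theorem restrict_Ioc_le_volPos {x y : ℝ} (hx : 0 < x) : volume.restrict (Ioc x y) ≤ volPos :=
  Measure.restrict_mono_set _ fun _ hz => hx.trans hz.1

theorem ae_wt_mul_rpow (t : ℝ) (v : ℝ → ℝ) {x y : ℝ} (hx : 0 < x) :
    ∀ᵐ z ∂(volume.restrict (Ioc x y)), wt t v z * z ^ (-(t / 2)) = v z := by
  filter_upwards [ae_restrict_mem measurableSet_Ioc] with z hz
  have hz0 : 0 < z := hx.trans hz.1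
  rw [wt, mul_right_comm, ← Real.rpow_add hz0]
  simp

theorem intervalIntegrable_of_memLp_wt {t : ℝ} {v : ℝ → ℝ} (hv : MemLp (wt t v) 2 volPos)
    {x y : ℝ} (hx : 0 < x) (hy : 0 < y) : IntervalIntegrable v volume x y := by
  have aux : ∀ {a b : ℝ}, 0 < a → IntegrableOn v (Ioc a b) := fun {a b} ha =>
    ((hv.mono_measure (restrict_Ioc_le_volPos ha)).integrable_mul
      (memLp_rpow_Ioc (-(t / 2)) ha)).congr (ae_wt_mul_rpow t v ha)
  exact ⟨aux hx, aux hy⟩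

/-- Between two positive points the inverse weight is bounded, hence in `L²`, and the integral is an
inner product with it. -/
theorem tendsto_intervalIntegral_of_eLpNorm_wt {t : ℝ} {v : ℝ → ℝ} {ψ : ℕ → ℝ → ℝ}
    (hv : MemLp (wt t v) 2 volPos) (hψ : ∀ n, MemLp (wt t (ψ n)) 2 volPos)
    (h : Tendsto (fun n => eLpNorm (wt t (ψ n) - wt t v) 2 volPos) atTop (𝓝 0))
    {x y : ℝ} (hx : 0 < x) (hy : 0 < y) :
    Tendsto (fun n => ∫ z in x..y, ψ n z) atTop (𝓝 (∫ z in x..y, v z)) := by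
  have aux : ∀ {a b : ℝ}, 0 < a →
      Tendsto (fun n => ∫ z in Ioc a b, ψ n z) atTop (𝓝 (∫ z in Ioc a b, v z)) := by
    intro a b ha
    have hm := restrict_Ioc_le_volPos (y := b) ha
    have ht : Tendsto (fun n => eLpNorm (wt t (ψ n) - wt t v) 2 (volume.restrict (Ioc a b)))
        atTop (𝓝 0) :=
      tendsto_of_tendsto_of_tendsto_of_le_of_le tendsto_const_nhds h (fun _ => zero_le)
        fun n => eLpNorm_mono_measure _ hm
    have hc := memLp_rpow_Ioc (y := b) (-(t / 2)) ha
    have := tendsto_integral_mul_of_eLpNorm (hv.mono_measure hm) hc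
      (fun n => (hψ n).mono_measure hm) (fun _ => hc) ht (by simp)
    rw [integral_congr_ae (ae_wt_mul_rpow t v ha)] at this
    exact this.congr fun n => integral_congr_ae (ae_wt_mul_rpow t (ψ n) ha)
  exact (aux hx).sub (aux hy)

/-- If `φ n → u` and `(φ n)' → v` in weighted `L²` spaces, then `u` is almost everywhere equal to
a primitive of `v`. -/
theorem exists_primitive_ae_eq {r t : ℝ} {u v : ℝ → ℝ} {φ ψ : ℕ → ℝ → ℝ}
    (hu : MemLp (wt r u) 2 volPos) (hv : MemLp (wt t v) 2 volPos)
    (hφ : ∀ n, MemLp (wt r (φ n)) 2 volPos) (hψ : ∀ n, MemLp (wt t (ψ n)) 2 volPos)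
    (tφ : Tendsto (fun n => eLpNorm (wt r (φ n) - wt r u) 2 volPos) atTop (𝓝 0))
    (tψ : Tendsto (fun n => eLpNorm (wt t (ψ n) - wt t v) 2 volPos) atTop (𝓝 0))
    (hd : ∀ n x, 0 < x → HasDerivAt (φ n) (ψ n x) x) :
    ∃ F : ℝ → ℝ, (∀ x y, 0 < x → 0 < y → F y - F x = ∫ z in x..y, v z) ∧ u =ᵐ[volPos] F := by
  -- A subsequence converges almost everywhere. With one point of convergence `x₀` as base point,
  -- the limit is taken in `φ y - φ x₀ = ∫ ψ`.
  obtain ⟨ns, hns, hae⟩ := (tendstoInMeasure_of_tendsto_eLpNorm (by norm_num)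
    (fun n => (hφ n).1) hu.1 tφ).exists_seq_tendsto_ae
  have hae' : ∀ᵐ x ∂volPos, 0 < x ∧ Tendsto (fun i => φ (ns i) x) atTop (𝓝 (u x)) := by
    filter_upwards [hae, ae_restrict_mem measurableSet_Ioi] with x hx hx0
    refine ⟨hx0, ?_⟩
    have hne : (x : ℝ) ^ (r / 2) ≠ 0 := (Real.rpow_pos_of_pos hx0 _).ne'
    have := hx.const_mul ((x ^ (r / 2))⁻¹)
    simpa [wt, ← mul_assoc, hne] using this
  have : NeBot (ae volPos) := by
    rw [ae_neBot]; intro h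
    have := congrArg (fun m => m univ) h
    simp [volPos] at this
  obtain ⟨x₀, hx₀, tx₀⟩ := hae'.exists
  refine ⟨fun y => u x₀ + ∫ z in x₀..y, v z, fun x y hx hy => ?_, ?_⟩
  · have := intervalIntegral.integral_interval_sub_left
      (intervalIntegrable_of_memLp_wt hv hx₀ hy) (intervalIntegrable_of_memLp_wt hv hx₀ hx)
    linarith
  · filter_upwards [hae'] with y hy
    have h1 := hy.2.sub tx₀
    have h2 := (tendsto_intervalIntegral_of_eLpNorm_wt hv hψ tψ hx₀ hy.1).comp hns.tendsto_atTop
    have h3 := tendsto_nhds_unique h1 (h2.congr fun i => ?_)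
    · linarith
    · refine intervalIntegral.integral_eq_sub_of_hasDerivAt (fun z hz => hd _ z ?_)
        (intervalIntegrable_of_memLp_wt (hψ _) hx₀ hy.1)
      exact (lt_min hx₀ hy.1).trans_le hz.1

theorem hasDerivAt_of_integral {F g : ℝ → ℝ}
    (hF : ∀ x y, 0 < x → 0 < y → F y - F x = ∫ z in x..y, g z) (hg : ContinuousOn g (Ioi 0))
    {x : ℝ} (hx : 0 < x) : HasDerivAt F (g x) x := by
  have hca : ContinuousAt g x := hg.continuousAt (Ioi_mem_nhds hx)
  have h := intervalIntegral.integral_hasDerivAt_right (a := x) (b := x) (f := g)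
    (by simp) (hg.stronglyMeasurableAtFilter isOpen_Ioi x hx) hca
  refine (h.const_add (F x)).congr_of_eventuallyEq ?_
  filter_upwards [Ioi_mem_nhds hx] with y hy
  linarith [hF x y hx hy]

theorem continuousOn_of_integral {F g : ℝ → ℝ}
    (hF : ∀ x y, 0 < x → 0 < y → F y - F x = ∫ z in x..y, g z)
    (hg : ∀ x y, 0 < x → 0 < y → IntervalIntegrable g volume x y) : ContinuousOn F (Ioi 0) := by
  intro x hx
  have hx : 0 < x := hx
  refine ContinuousAt.continuousWithinAt ?_
  have hi := hg (x / 2) (2 * x) (by linarith) (by linarith)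
  have h := intervalIntegral.continuousOn_primitive_interval' hi (a := x) (by
    rw [uIcc_of_le (by linarith)]; constructor <;> linarith)
  have h2 : ContinuousAt (fun y => ∫ z in x..y, g z) x := h.continuousAt (by
    rw [uIcc_of_le (by linarith)]; exact Icc_mem_nhds (by linarith) (by linarith))
  refine ContinuousAt.congr (h2.const_add (F x) |>.congr (Eventually.of_forall fun _ => rfl)) ?_
  filter_upwards [Ioi_mem_nhds hx] with y hy
  linarith [hF x y hx hy]

/-- Elements of the completion have a representative that is continuously differentiable with
absolutely continuous derivative. -/
theorem MemEbar.exists_representative {μ : ℝ} {f f₁ f₂ : ℝ → ℝ} (h : MemEbar μ f f₁ f₂) :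
    ∃ F G : ℝ → ℝ, (∀ x, 0 < x → HasDerivAt F (G x) x) ∧ ContinuousOn G (Ioi 0) ∧
      (∀ x y, 0 < x → 0 < y → G y - G x = ∫ z in x..y, f₂ z) ∧
      f =ᵐ[volPos] F ∧ f₁ =ᵐ[volPos] G := by
  obtain ⟨J, φ, hφ, tX, tY, tZ, tW⟩ := h.exists_seq
  have K := fun n => (hφ n).jetMemLp
  obtain ⟨F, hF, eF⟩ := exists_primitive_ae_eq J.memW J.memZ (fun n => (K n).memW)
    (fun n => (K n).memZ) tW tZ (fun n x hx => (hφ n).hasDerivAt hx)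
  obtain ⟨G, hG, eG⟩ := exists_primitive_ae_eq J.memY J.memX (fun n => (K n).memY)
    (fun n => (K n).memX) tY tX (fun n x hx => (hφ n).hasDerivAt_deriv hx)
  have cG : ContinuousOn G (Ioi 0) := continuousOn_of_integral hG
    fun x y hx hy => intervalIntegrable_of_memLp_wt J.memX hx hy
  refine ⟨F, G, fun x hx => hasDerivAt_of_integral (fun x y hx hy => ?_) cG hx, cG, hG, eF, eG⟩
  rw [hF x y hx hy]
  refine intervalIntegral.integral_congr_ae ?_
  have eG' := (ae_restrict_iff' measurableSet_Ioi).1 eG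
  filter_upwards [eG'] with z hz hz'
  exact hz ((lt_min hx hy).trans hz'.1)

theorem eqOn_of_ae_eq_volPos {F g : ℝ → ℝ} (hF : ContinuousOn F (Ioi 0))
    (hg : ContinuousOn g (Ioi 0)) (h : F =ᵐ[volPos] g) : EqOn F g (Ioi 0) :=
  Measure.eqOn_open_of_ae_eq h isOpen_Ioi hF hg

/-- An element of the completion that is almost everywhere equal to a twice continuously
differentiable function has the classical derivatives. -/
theorem MemEbar.ae_eq_derivatives {μ : ℝ} {f f₁ f₂ g g₁ g₂ : ℝ → ℝ} (h : MemEbar μ f f₁ f₂)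
    (hg : ∀ x, 0 < x → HasDerivAt g (g₁ x) x) (hg₁ : ∀ x, 0 < x → HasDerivAt g₁ (g₂ x) x)
    (he : f =ᵐ[volPos] g) : f₁ =ᵐ[volPos] g₁ ∧ f₂ =ᵐ[volPos] g₂ := by
  obtain ⟨F, G, hF, cG, hG, eF, eG⟩ := h.exists_representative
  have J := h.jetMemLp
  have e0 : EqOn F g (Ioi 0) := eqOn_of_ae_eq_volPos
    (fun x hx => (hF x hx).continuousAt.continuousWithinAt)
    (fun x hx => (hg x hx).continuousAt.continuousWithinAt) (eF.symm.trans he)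
  have e1 : EqOn G g₁ (Ioi 0) := fun x hx => (hF x hx).unique
    ((hg x hx).congr_of_eventuallyEq (e0.eventuallyEq_of_mem (Ioi_mem_nhds hx)))
  refine ⟨eG.trans ((ae_restrict_iff' measurableSet_Ioi).2 (Eventually.of_forall e1)), ?_⟩
  -- Lebesgue differentiation on intervals exhausting `(0, ∞)`: `G` is a primitive of `f₂`, so `G' =
  -- f₂` almost everywhere, whereas `G = g₁` everywhere.
  have hL : ∀ n : ℕ, ∀ᵐ x, x ∈ uIcc (1 / ((n : ℝ) + 1)) (n + 1) →
      ∀ c ∈ uIcc (1 / ((n : ℝ) + 1)) (n + 1),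
        HasDerivAt (fun x => ∫ z in c..x, f₂ z) (f₂ x) x := fun n =>
    (intervalIntegrable_of_memLp_wt J.memX (by positivity) (by positivity)).ae_hasDerivAt_integral
  refine (ae_restrict_iff' measurableSet_Ioi).2 ?_
  filter_upwards [ae_all_iff.2 hL] with x hx hx0
  have hx0 : 0 < x := hx0
  obtain ⟨n, hn⟩ := exists_nat_gt (max x (1 / x))
  have hn1 : x < n := (le_max_left _ _).trans_lt hn
  have hn2 : 1 / x < n := (le_max_right _ _).trans_lt hn
  have hx' : x ∈ uIcc (1 / ((n : ℝ) + 1)) (n + 1) := by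
    rw [mem_uIcc]
    refine Or.inl ⟨?_, by linarith⟩
    rw [div_le_iff₀ (by positivity)]
    rw [div_lt_iff₀ hx0] at hn2
    nlinarith
  have h1 := (hx n hx' x hx').const_add (G x)
  have h2 : HasDerivAt G (f₂ x) x := by
    refine h1.congr_of_eventuallyEq ?_
    filter_upwards [Ioi_mem_nhds hx0] with y hy
    linarith [hG x y hx0 hy]
  exact h2.unique ((hg₁ x hx0).congr_of_eventuallyEq (e1.eventuallyEq_of_mem (Ioi_mem_nhds hx0)))

/-! ### Wronskian and uniqueness for the differential equation -/

/-- `g`, with derivatives `g₁` and `g₂`, solves `x g'' + (l x + μ) g' + l s g = 0` on `(0, ∞)`. -/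
structure IsKummerSol (μ s l : ℝ) (g g₁ g₂ : ℝ → ℝ) : Prop where
  hasDerivAt : ∀ x, 0 < x → HasDerivAt g (g₁ x) x
  hasDerivAt₁ : ∀ x, 0 < x → HasDerivAt g₁ (g₂ x) x
  ode : ∀ x, 0 < x → x * g₂ x + (l * x + μ) * g₁ x + l * s * g x = 0

theorem IsKummerSol.const_mul {μ s l : ℝ} {g g₁ g₂ : ℝ → ℝ} (h : IsKummerSol μ s l g g₁ g₂) (C : ℝ) :
    IsKummerSol μ s l (fun x => C * g x) (fun x => C * g₁ x) (fun x => C * g₂ x) :=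
  ⟨fun x hx => (h.1 x hx).const_mul C, fun x hx => (h.2 x hx).const_mul C,
    fun x hx => by linear_combination C * h.3 x hx⟩

theorem IsKummerSol.sub {μ s l : ℝ} {g g₁ g₂ F G H : ℝ → ℝ} (h : IsKummerSol μ s l F G H)
    (k : IsKummerSol μ s l g g₁ g₂) :
    IsKummerSol μ s l (fun x => F x - g x) (fun x => G x - g₁ x) (fun x => H x - g₂ x) :=
  ⟨fun x hx => (h.1 x hx).sub (k.1 x hx), fun x hx => (h.2 x hx).sub (k.2 x hx),
    fun x hx => by linear_combination h.3 x hx - k.3 x hx⟩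

/-- Abel's identity: `x ^ μ exp (l x)` is the integrating factor of `x y'' + (l x + μ) y'`. -/
theorem IsKummerSol.wronskian_eq {μ s l : ℝ} {g g₁ g₂ F G H : ℝ → ℝ} (h : IsKummerSol μ s l F G H)
    (k : IsKummerSol μ s l g g₁ g₂) {x y : ℝ} (hx : 0 < x) (hy : 0 < y) :
    x ^ μ * Real.exp (l * x) * (F x * g₁ x - G x * g x) =
      y ^ μ * Real.exp (l * y) * (F y * g₁ y - G y * g y) := by
  have hd : ∀ z, 0 < z →
      HasDerivAt (fun z => z ^ μ * Real.exp (l * z) * (F z * g₁ z - G z * g z)) 0 z := by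
    intro z hz
    have e : HasDerivAt (fun z => Real.exp (l * z)) (Real.exp (l * z) * (l * 1)) z :=
      ((hasDerivAt_id z).const_mul l).exp
    have := ((Real.hasDerivAt_rpow_const (p := μ) (Or.inl hz.ne')).mul e).mul
      (((h.1 z hz).mul (k.2 z hz)).sub ((h.2 z hz).mul (k.1 z hz)))
    refine this.congr_deriv ?_
    simp only [Pi.mul_apply, Pi.sub_apply]
    rw [Real.rpow_sub_one hz.ne']
    field_simp
    linear_combination z ^ μ * Real.exp (z * l) * (F z * k.3 z hz - g z * h.3 z hz)
  exact isOpen_Ioi.is_const_of_deriv_eq_zero isPreconnected_Ioi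
    (fun z hz => (hd z hz).differentiableAt.differentiableWithinAt)
    (fun z hz => (hd z hz).deriv) hx hy

/-- The weighted Wronskian is constant, so its limit at `0` suffices. Writing `x ^ μ x ^ m = x ^ (μ
/ 2) x ^ (m + μ / 2)`, the first factor is absorbed by `F` and `G`, which gives quantities tending
to zero, and the second is at most `1` on `(0, 1]`. -/
theorem IsKummerSol.wronskian_eq_zero {μ s l K m : ℝ} {g g₁ g₂ F G H : ℝ → ℝ}
    (h : IsKummerSol μ s l F G H) (k : IsKummerSol μ s l g g₁ g₂)
    (tF : Tendsto (fun x => x ^ μ * (F x * F x)) (𝓝[>] 0) (𝓝 0))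
    (tG : Tendsto (fun x => x ^ μ * (G x * G x)) (𝓝[>] 0) (𝓝 0))
    (hg : ∀ x, 0 < x → x ≤ 1 → |g x| ≤ K * x ^ m) (hg₁ : ∀ x, 0 < x → x ≤ 1 → |g₁ x| ≤ K * x ^ m)
    (hm : 0 ≤ m + μ / 2) {y : ℝ} (hy : 0 < y) : F y * g₁ y - G y * g y = 0 := by
  have sq : ∀ {Q : ℝ → ℝ}, Tendsto (fun x => x ^ μ * (Q x * Q x)) (𝓝[>] 0) (𝓝 0) →
      Tendsto (fun x => x ^ (μ / 2) * |Q x|) (𝓝[>] 0) (𝓝 0) := by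
    intro Q hQ
    have := (Real.continuous_sqrt.tendsto 0).comp hQ
    rw [Real.sqrt_zero] at this
    refine this.congr' ?_
    filter_upwards [self_mem_nhdsWithin] with x hx
    have hx : 0 < x := hx
    simp only [Function.comp]
    rw [Real.sqrt_mul (by positivity), Real.sqrt_mul_self_eq_abs, Real.sqrt_eq_rpow,
      ← Real.rpow_mul hx.le]
    congr 2; ring
  have ht : Tendsto (fun x => Real.exp |l| * K * (x ^ (μ / 2) * |F x| + x ^ (μ / 2) * |G x|)) (𝓝[>] 0)
      (𝓝 0) := by simpa using ((sq tF).add (sq tG)).const_mul (Real.exp |l| * K)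
  have hP : Tendsto (fun x => x ^ μ * Real.exp (l * x) * (F x * g₁ x - G x * g x)) (𝓝[>] 0) (𝓝 0) := by
    refine squeeze_zero_norm' ?_ ht
    filter_upwards [Ioc_mem_nhdsGT (zero_lt_one (α := ℝ))] with x hx
    obtain ⟨hx0, hx1⟩ := hx
    have e1 : Real.exp (l * x) ≤ Real.exp |l| := by
      refine Real.exp_le_exp.2 ((le_abs_self _).trans ?_)
      rw [abs_mul, abs_of_pos hx0]
      exact mul_le_of_le_one_right (abs_nonneg l) hx1
    have hK : 0 ≤ K * x ^ m := (abs_nonneg _).trans (hg x hx0 hx1)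
    have e2 : |F x * g₁ x - G x * g x| ≤ (|F x| + |G x|) * (K * x ^ m) := by
      refine (abs_sub _ _).trans ?_
      rw [abs_mul, abs_mul, add_mul]
      exact add_le_add (mul_le_mul_of_nonneg_left (hg₁ x hx0 hx1) (abs_nonneg _))
        (mul_le_mul_of_nonneg_left (hg x hx0 hx1) (abs_nonneg _))
    have e3 : x ^ (m + μ / 2) ≤ 1 := Real.rpow_le_one hx0.le hx1 hm
    have hK' : 0 ≤ K := nonneg_of_mul_nonneg_left hK (Real.rpow_pos_of_pos hx0 m)
    have e4 : x ^ μ * x ^ m = x ^ (μ / 2) * x ^ (m + μ / 2) := by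
      rw [← Real.rpow_add hx0, ← Real.rpow_add hx0]; congr 1; ring
    rw [Real.norm_eq_abs, abs_mul, abs_mul, abs_of_pos (Real.rpow_pos_of_pos hx0 μ), Real.abs_exp]
    have hxμ := Real.rpow_pos_of_pos hx0 μ
    have hxμ2 := Real.rpow_pos_of_pos hx0 (μ / 2)
    calc x ^ μ * Real.exp (l * x) * |F x * g₁ x - G x * g x|
        ≤ x ^ μ * Real.exp |l| * ((|F x| + |G x|) * (K * x ^ m)) := by gcongr
      _ = Real.exp |l| * K * (|F x| + |G x|) * (x ^ μ * x ^ m) := by ring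
      _ = Real.exp |l| * K * (|F x| + |G x|) * (x ^ (μ / 2) * x ^ (m + μ / 2)) := by rw [e4]
      _ ≤ Real.exp |l| * K * (|F x| + |G x|) * (x ^ (μ / 2) * 1) := by gcongr
      _ = _ := by ring
  have hc : Tendsto (fun x => x ^ μ * Real.exp (l * x) * (F x * g₁ x - G x * g x)) (𝓝[>] 0)
      (𝓝 (y ^ μ * Real.exp (l * y) * (F y * g₁ y - G y * g y))) := by
    refine tendsto_const_nhds.congr' ?_
    filter_upwards [self_mem_nhdsWithin] with x hx
    exact h.wronskian_eq k hy hx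
  have := tendsto_nhds_unique hc hP
  exact (mul_eq_zero.1 this).resolve_left
    (mul_pos (Real.rpow_pos_of_pos hy μ) (Real.exp_pos _)).ne'

/-- A Grönwall argument for `u² + u₁²`, run forwards or backwards from `x₀`; the coefficients `l + μ
/ x` and `l s / x` are bounded on `[a, ∞)`. -/
theorem IsKummerSol.eq_zero_of_initial {μ s l : ℝ} {u u₁ u₂ : ℝ → ℝ} (h : IsKummerSol μ s l u u₁ u₂)
    {x₀ : ℝ} (hx₀ : 0 < x₀) (h0 : u x₀ = 0) (h1 : u₁ x₀ = 0) {y : ℝ} (hy : 0 < y) : u y = 0 := by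
  set a := min x₀ y with ha
  have ha0 : 0 < a := lt_min hx₀ hy
  -- The summands bound the contributions of `2 u u₁`, of the `u₁` term of `u₂`, and of its `u`
  -- term.
  set K := 1 + 2 * (|l| + |μ| / a) + |l * s| / a with hK
  have hd : ∀ x, 0 < x → HasDerivAt (fun x => u x ^ 2 + u₁ x ^ 2)
      (2 * u x * u₁ x + 2 * u₁ x * u₂ x) x := by
    intro x hx
    refine (((h.1 x hx).pow 2).add ((h.2 x hx).pow 2)).congr_deriv ?_
    norm_num
  have bound : ∀ x, a ≤ x → |2 * u x * u₁ x + 2 * u₁ x * u₂ x| ≤ K * (u x ^ 2 + u₁ x ^ 2) := by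
    intro x hx
    have hx0 : 0 < x := ha0.trans_le hx
    have e : u₂ x = -(l + μ / x) * u₁ x - l * s / x * u x := by
      field_simp
      linear_combination h.3 x hx0
    have b1 : |l + μ / x| ≤ |l| + |μ| / a := by
      refine (abs_add_le _ _).trans ?_
      rw [abs_div, abs_of_pos hx0]
      gcongr
    have b2 : |l * s / x| ≤ |l * s| / a := by
      rw [abs_div, abs_of_pos hx0]
      gcongr
    rw [e, hK]
    generalize |l| + |μ| / a = M at b1 ⊢
    generalize |l * s| / a = N at b2 ⊢
    generalize l + μ / x = p at b1 ⊢
    generalize l * s / x = q at b2 ⊢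
    obtain ⟨p1, p2⟩ := abs_le.1 b1
    obtain ⟨q1, q2⟩ := abs_le.1 b2
    have s1 := sq_nonneg (u x - u₁ x)
    have s2 := sq_nonneg (u x + u₁ x)
    have s3 := sq_nonneg (u₁ x)
    have s4 := sq_nonneg (u x)
    rw [abs_le]
    constructor <;>
    nlinarith [mul_nonneg (sub_nonneg.2 p2) s3, mul_nonneg (sub_nonneg.2 p1) s3,
      mul_nonneg (sub_nonneg.2 q1) s1, mul_nonneg (sub_nonneg.2 q2) s1,
      mul_nonneg (sub_nonneg.2 q1) s2, mul_nonneg (sub_nonneg.2 q2) s2,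
      mul_nonneg (b1.trans' (abs_nonneg _)) s4]
  have hexp : ∀ c x : ℝ, HasDerivAt (fun x => Real.exp (c * x)) (Real.exp (c * x) * (c * 1)) x :=
    fun c x => ((hasDerivAt_id x).const_mul c).exp
  have hd2 : ∀ c x : ℝ, 0 < x → HasDerivAt (fun x => Real.exp (c * x) * (u x ^ 2 + u₁ x ^ 2))
      (Real.exp (c * x) * (c * (u x ^ 2 + u₁ x ^ 2) + (2 * u x * u₁ x + 2 * u₁ x * u₂ x))) x := by
    intro c x hx
    refine ((hexp c x).mul (hd x hx)).congr_deriv ?_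
    ring
  have key : u y ^ 2 + u₁ y ^ 2 ≤ 0 := by
    rcases le_total x₀ y with hxy | hxy
    · have hanti : AntitoneOn (fun x => Real.exp (-K * x) * (u x ^ 2 + u₁ x ^ 2)) (Icc x₀ y) := by
        refine antitoneOn_of_hasDerivWithinAt_nonpos (convex_Icc _ _)
          (fun x hx => (hd2 _ x (hx₀.trans_le hx.1)).continuousAt.continuousWithinAt)
          (fun x hx => (hd2 _ x (hx₀.trans_le (interior_subset hx).1)).hasDerivWithinAt)
          fun x hx => ?_
        have := (abs_le.1 (bound x ((min_le_left _ _).trans (interior_subset hx).1))).2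
        exact mul_nonpos_of_nonneg_of_nonpos (Real.exp_pos _).le (by linarith)
      have := hanti (left_mem_Icc.2 hxy) (right_mem_Icc.2 hxy) hxy
      simp only [h0, h1] at this
      norm_num at this
      exact nonpos_of_mul_nonpos_right this (Real.exp_pos _)
    · have hmono : MonotoneOn (fun x => Real.exp (K * x) * (u x ^ 2 + u₁ x ^ 2)) (Icc y x₀) := by
        refine monotoneOn_of_hasDerivWithinAt_nonneg (convex_Icc _ _)
          (fun x hx => (hd2 _ x (hy.trans_le hx.1)).continuousAt.continuousWithinAt)
          (fun x hx => (hd2 _ x (hy.trans_le (interior_subset hx).1)).hasDerivWithinAt)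
          fun x hx => ?_
        have := (abs_le.1 (bound x ((min_le_right _ _).trans (interior_subset hx).1))).1
        exact mul_nonneg (Real.exp_pos _).le (by linarith)
      have := hmono (left_mem_Icc.2 hxy) (right_mem_Icc.2 hxy) hxy
      simp only [h0, h1] at this
      norm_num at this
      exact nonpos_of_mul_nonpos_right this (Real.exp_pos _)
  nlinarith [sq_nonneg (u y), sq_nonneg (u₁ y)]

/-- Two solutions with vanishing Wronskian at a point where the second one does not vanish are
proportional. -/
theorem IsKummerSol.eq_const_mul {μ s l : ℝ} {g g₁ g₂ F G H : ℝ → ℝ} (h : IsKummerSol μ s l F G H)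
    (k : IsKummerSol μ s l g g₁ g₂) {x₀ : ℝ} (hx₀ : 0 < x₀) (hg : g x₀ ≠ 0)
    (hW : F x₀ * g₁ x₀ - G x₀ * g x₀ = 0) : ∃ C, ∀ x, 0 < x → F x = C * g x := by
  refine ⟨F x₀ / g x₀, fun x hx => ?_⟩
  have := (h.sub (k.const_mul (F x₀ / g x₀))).eq_zero_of_initial hx₀ (by field_simp; ring)
    (by field_simp; linarith) hx
  linarith

/-! ### Power series and Kummer's equation -/

/-- The sum of a real power series. -/
noncomputable def powSum (c : ℕ → ℝ) (x : ℝ) : ℝ := ∑' k, c k * x ^ k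

/-- The coefficients of the derivative of a power series. -/
def derivCoeff (c : ℕ → ℝ) (k : ℕ) : ℝ := ((k : ℝ) + 1) * c (k + 1)

/-- The coefficients of an everywhere convergent power series. -/
def EntireCoeff (c : ℕ → ℝ) : Prop := ∀ r : ℝ, 0 ≤ r → Summable fun k => |c k| * r ^ k

theorem EntireCoeff.summable {c : ℕ → ℝ} (h : EntireCoeff c) (x : ℝ) :
    Summable fun k => c k * x ^ k := by
  refine Summable.of_norm ((h |x| (abs_nonneg x)).congr fun k => ?_)
  simp

theorem EntireCoeff.deriv {c : ℕ → ℝ} (h : EntireCoeff c) : EntireCoeff (derivCoeff c) := by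
  intro r hr
  -- The factor `k + 1` is absorbed by doubling the radius; `r + 1 ≥ 1` allows the exponent to rise
  -- from `k` to `k + 1`.
  have h1 := (summable_nat_add_iff 1).2 (h (2 * (r + 1)) (by positivity))
  refine Summable.of_nonneg_of_le (fun k => by positivity) (fun k => ?_) h1
  have e1 : (k : ℝ) + 1 ≤ 2 ^ (k + 1) := by exact_mod_cast (Nat.lt_two_pow_self (n := k + 1)).le
  have e2 : r ^ k ≤ (r + 1) ^ (k + 1) :=
    (pow_le_pow_left₀ hr (by linarith) k).trans (pow_le_pow_right₀ (by linarith) (by omega))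
  rw [derivCoeff, abs_mul, abs_of_nonneg (by positivity : (0 : ℝ) ≤ (k : ℝ) + 1), mul_pow]
  calc ((k : ℝ) + 1) * |c (k + 1)| * r ^ k
      ≤ 2 ^ (k + 1) * |c (k + 1)| * (r + 1) ^ (k + 1) := by gcongr
    _ = _ := by ring

theorem EntireCoeff.hasDerivAt {c : ℕ → ℝ} (h : EntireCoeff c) (x : ℝ) :
    HasDerivAt (powSum c) (powSum (derivCoeff c) x) x := by
  set R := |x| + 1 with hR
  have hR0 : 0 ≤ R := by positivity
  have hu : Summable fun n : ℕ => |c n| * (n * R ^ (n - 1)) := by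
    refine (summable_nat_add_iff 1).1 ((h.deriv R hR0).congr fun k => ?_)
    rw [derivCoeff, abs_mul, abs_of_nonneg (by positivity : (0 : ℝ) ≤ (k : ℝ) + 1)]
    push_cast
    ring
  have hx : x ∈ Metric.ball (0 : ℝ) R := by simp [hR]
  have hb : ∀ (n : ℕ) (y : ℝ), y ∈ Metric.ball (0 : ℝ) R →
      ‖c n * ((n : ℝ) * y ^ (n - 1))‖ ≤ |c n| * (n * R ^ (n - 1)) := by
    intro n y hy
    have hy : |y| ≤ R := by simpa using (Metric.mem_ball.1 hy).le
    rw [norm_mul, norm_mul, norm_pow, Real.norm_eq_abs, Real.norm_eq_abs, Real.norm_eq_abs,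
      Nat.abs_cast]
    gcongr
  have key := hasDerivAt_tsum_of_isPreconnected hu Metric.isOpen_ball
    (convex_ball (0 : ℝ) R).isPreconnected (g := fun n y => c n * y ^ n)
    (g' := fun n y => c n * ((n : ℝ) * y ^ (n - 1)))
    (fun n y _ => (hasDerivAt_pow n y).const_mul (c n)) hb hx (h.summable x) hx
  have hs : Summable fun n : ℕ => c n * ((n : ℝ) * x ^ (n - 1)) :=
    Summable.of_norm_bounded hu fun n => hb n x hx
  have e : (∑' n : ℕ, c n * ((n : ℝ) * x ^ (n - 1))) = powSum (derivCoeff c) x := by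
    rw [hs.tsum_eq_zero_add]
    simp only [powSum, derivCoeff, Nat.cast_zero, zero_mul, mul_zero, zero_add, Nat.cast_add,
      Nat.cast_one, Nat.add_sub_cancel]
    congr 1; funext k; ring
  rw [e] at key
  exact key

theorem EntireCoeff.contDiff {c : ℕ → ℝ} (h : EntireCoeff c) : ContDiff ℝ ∞ (powSum c) := by
  rw [contDiff_infty]
  intro n
  induction n generalizing c with
  | zero =>
    exact contDiff_zero.2 (continuous_iff_continuousAt.2 fun x => (h.hasDerivAt x).continuousAt)
  | succ n ih =>
    push_cast
    rw [contDiff_succ_iff_deriv]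
    refine ⟨fun x => (h.hasDerivAt x).differentiableAt, by simp, ?_⟩
    rw [show _root_.deriv (powSum c) = powSum (derivCoeff c) from
      funext fun x => (h.hasDerivAt x).deriv]
    exact ih h.deriv

/-- The coefficients of the Kummer series. -/
noncomputable def kummerCoeff (a c : ℝ) (k : ℕ) : ℝ :=
  (ascPochhammer ℝ k).eval a / (ascPochhammer ℝ k).eval c / (k.factorial : ℝ)

theorem kummer_eq_powSum (a c : ℝ) : kummer a c = powSum (kummerCoeff a c) := by
  funext x
  rw [kummer, powSum]
  congr 1; funext k
  rw [kummerCoeff]; ring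

theorem kummerCoeff_succ {a c : ℝ} (hc : 0 < c) (k : ℕ) :
    (c + k) * ((k : ℝ) + 1) * kummerCoeff a c (k + 1) = (a + k) * kummerCoeff a c k := by
  have h1 : (ascPochhammer ℝ k).eval c ≠ 0 := (ascPochhammer_pos k c hc).ne'
  have h2 : c + k ≠ 0 := by positivity
  have h3 : (k.factorial : ℝ) ≠ 0 := by positivity
  have h4 : (k : ℝ) + 1 ≠ 0 := by positivity
  simp only [kummerCoeff, ascPochhammer_succ_eval, Nat.factorial_succ]
  push_cast
  field_simp

theorem entireCoeff_kummerCoeff {a c : ℝ} (hc : 0 < c) : EntireCoeff (kummerCoeff a c) := by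
  intro r hr
  refine summable_of_ratio_norm_eventually_le (r := 1 / 2) (by norm_num) ?_
  -- The ratio of consecutive terms is at most `(|a| + 1) r / (c + k)`, which is at most `1 / 2`
  -- from this index on.
  filter_upwards [eventually_ge_atTop ⌈2 * ((|a| + 1) * r)⌉₊] with k hk
  have hk' : 2 * ((|a| + 1) * r) ≤ k := (Nat.le_ceil _).trans (by exact_mod_cast hk)
  have hck : 0 < c + k := by positivity
  have hk1 : (0 : ℝ) < (k : ℝ) + 1 := by positivity
  have e := congrArg abs (kummerCoeff_succ (a := a) hc k)
  rw [abs_mul, abs_mul, abs_mul, abs_of_pos hck, abs_of_pos hk1] at e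
  have ha : |a + k| ≤ (|a| + 1) * (k + 1) := by
    refine (abs_add_le _ _).trans ?_
    rw [abs_of_nonneg (Nat.cast_nonneg (α := ℝ) k)]
    nlinarith [abs_nonneg a, Nat.cast_nonneg (α := ℝ) k]
  have h2 : (c + k) * |kummerCoeff a c (k + 1)| ≤ (|a| + 1) * |kummerCoeff a c k| := by
    have : (c + k) * |kummerCoeff a c (k + 1)| * (k + 1) ≤ (|a| + 1) * |kummerCoeff a c k| * (k + 1) := by
      calc (c + k) * |kummerCoeff a c (k + 1)| * (k + 1) = |a + k| * |kummerCoeff a c k| := by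
            rw [← e]; ring
        _ ≤ (|a| + 1) * (k + 1) * |kummerCoeff a c k| := by gcongr
        _ = _ := by ring
    exact le_of_mul_le_mul_right this hk1
  simp only [norm_mul, norm_pow, Real.norm_eq_abs, abs_abs, abs_of_nonneg hr, pow_succ]
  have h3 : |kummerCoeff a c (k + 1)| * r ≤ 1 / 2 * |kummerCoeff a c k| := by
    have : (c + k) * (|kummerCoeff a c (k + 1)| * r) ≤ (c + k) * (1 / 2 * |kummerCoeff a c k|) := by
      nlinarith [mul_le_mul_of_nonneg_right h2 hr, mul_le_mul_of_nonneg_right hk'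
        (abs_nonneg (kummerCoeff a c k)), mul_nonneg hc.le (abs_nonneg (kummerCoeff a c k))]
    exact le_of_mul_le_mul_left this hck
  nlinarith [mul_le_mul_of_nonneg_right h3 (pow_nonneg hr k)]

/-- Comparison of the coefficients of `x ^ k`: the recursion is exactly the vanishing of `(k + γ) (k
+ 1) c (k + 1) - (k + a) c k`. -/
theorem EntireCoeff.kummer_ode {a γ : ℝ} {c : ℕ → ℝ} (h : EntireCoeff c)
    (hc : ∀ k : ℕ, (γ + k) * ((k : ℝ) + 1) * c (k + 1) = (a + k) * c k) (x : ℝ) :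
    x * powSum (derivCoeff (derivCoeff c)) x + (γ - x) * powSum (derivCoeff c) x
      - a * powSum c x = 0 := by
  have s0 := (h.summable x).hasSum
  have s1 := (h.deriv.summable x).hasSum
  have s2 := (h.deriv.deriv.summable x).hasSum
  have t2 : HasSum (fun k : ℕ => (k : ℝ) * ((k : ℝ) + 1) * c (k + 1) * x ^ k)
      (x * powSum (derivCoeff (derivCoeff c)) x) := by
    rw [← hasSum_nat_add_iff' 1]
    simp only [Finset.range_one, Finset.sum_singleton, Nat.cast_zero, zero_mul, sub_zero]
    refine (s2.mul_left x).congr_fun fun k => ?_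
    simp only [derivCoeff]; push_cast; ring
  have t1 : HasSum (fun k : ℕ => (k : ℝ) * c k * x ^ k) (x * powSum (derivCoeff c) x) := by
    rw [← hasSum_nat_add_iff' 1]
    simp only [Finset.range_one, Finset.sum_singleton, Nat.cast_zero, zero_mul, sub_zero]
    refine (s1.mul_left x).congr_fun fun k => ?_
    simp only [derivCoeff]; push_cast; ring
  have t := ((t2.add (s1.mul_left γ)).sub t1).sub (s0.mul_left a)
  have t0 := t.unique ((hasSum_zero (α := ℝ) (β := ℕ)).congr_fun fun k => ?_)
  · simp only [powSum] at t0 ⊢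
    linarith
  · simp only [derivCoeff]
    linear_combination x ^ k * hc k

theorem powSum_kummerCoeff_zero (a c : ℝ) : powSum (kummerCoeff a c) 0 = 1 := by
  rw [powSum, tsum_eq_single 0 (fun k hk => by simp [hk])]
  simp [kummerCoeff]

/-! ### The explicit solutions and their behaviour at the origin -/

/-- A smooth solution of the differential equation that belongs to the larger exponent at `0`
(one of `0` and `1 - μ`). -/
structure IsRegularKummerSol (μ s l : ℝ) (g g₁ g₂ : ℝ → ℝ) : Prop
    extends IsKummerSol μ s l g g₁ g₂ where
  contDiffOn : ContDiffOn ℝ ∞ g (Ioi 0)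
  near_zero : ∃ c₀ c₁ c₂ : ℝ → ℝ, Continuous c₀ ∧ Continuous c₁ ∧ Continuous c₂ ∧ ∀ x, 0 < x →
    g x = x ^ ((|μ| - μ) / 2) * c₀ x ∧ g₁ x = x ^ ((|μ| - μ) / 2) * c₁ x ∧
      x * g₂ x = x ^ ((|μ| - μ) / 2) * c₂ x

theorem IsRegularKummerSol.const_mul {μ s l : ℝ} {g g₁ g₂ : ℝ → ℝ}
    (h : IsRegularKummerSol μ s l g g₁ g₂) (C : ℝ) :
    IsRegularKummerSol μ s l (fun x => C * g x) (fun x => C * g₁ x) (fun x => C * g₂ x) := by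
  obtain ⟨c₀, c₁, c₂, h0, h1, h2, hc⟩ := h.near_zero
  refine ⟨h.toIsKummerSol.const_mul C, contDiffOn_const.mul h.contDiffOn, fun x => C * c₀ x,
    fun x => C * c₁ x, fun x => C * c₂ x, h0.const_mul C, h1.const_mul C, h2.const_mul C,
    fun x hx => ?_⟩
  obtain ⟨e0, e1, e2⟩ := hc x hx
  exact ⟨by rw [e0]; ring, by rw [e1]; ring, by linear_combination C * e2⟩

/-- Conjugation by `exp (-l x)` and rescaling yield Kummer's equation with parameters `μ - s = b`
and `μ`. -/
theorem isRegularKummerSol_of_pos {μ b l : ℝ} (hμ : 0 < μ) :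
    ∃ g₁ g₂, IsRegularKummerSol μ (μ - b) l
      (fun x => Real.exp (-(l * x)) * kummer b μ (l * x)) g₁ g₂ := by
  rw [kummer_eq_powSum]
  have hc := entireCoeff_kummerCoeff (a := b) hμ
  have hode := hc.kummer_ode (kummerCoeff_succ (a := b) hμ)
  set c := kummerCoeff b μ
  have d0 : ∀ x, HasDerivAt (fun x => powSum c (l * x)) (powSum (derivCoeff c) (l * x) * l) x :=
    fun x => (hc.hasDerivAt (l * x)).comp x (hasDerivAt_const_mul l)
  have d1 : ∀ x, HasDerivAt (fun x => powSum (derivCoeff c) (l * x))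
      (powSum (derivCoeff (derivCoeff c)) (l * x) * l) x :=
    fun x => (hc.deriv.hasDerivAt (l * x)).comp x (hasDerivAt_const_mul l)
  have de : ∀ x, HasDerivAt (fun x => Real.exp (-(l * x))) (Real.exp (-(l * x)) * -l) x :=
    fun x => (hasDerivAt_const_mul l).neg.exp
  have s0 := hc.contDiff
  have s1 := hc.deriv.contDiff
  have s2 := hc.deriv.deriv.contDiff
  have k0 := s0.continuous
  have k1 := s1.continuous
  have k2 := s2.continuous
  have hm : (|μ| - μ) / 2 = 0 := by rw [abs_of_pos hμ]; ring
  refine ⟨fun x => l * (Real.exp (-(l * x)) * (powSum (derivCoeff c) (l * x) - powSum c (l * x))),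
    fun x => l ^ 2 * (Real.exp (-(l * x)) * (powSum (derivCoeff (derivCoeff c)) (l * x)
      - 2 * powSum (derivCoeff c) (l * x) + powSum c (l * x))), ⟨?_, ?_, ?_⟩, ?_, ?_⟩
  · intro x _
    refine ((de x).mul (d0 x)).congr_deriv ?_
    ring
  · intro x _
    refine (((de x).mul ((d1 x).sub (d0 x))).const_mul l).congr_deriv ?_
    simp only [Pi.sub_apply]
    ring
  · intro x _
    linear_combination l * Real.exp (-(l * x)) * hode (l * x)
  · exact ((Real.contDiff_exp.comp (contDiff_const.mul contDiff_id).neg).mul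
      (s0.comp (contDiff_const.mul contDiff_id))).contDiffOn
  · rw [hm]
    simp only [Real.rpow_zero, one_mul]
    refine ⟨_, _, _, ?_, ?_, ?_, fun x _ => ⟨rfl, rfl, rfl⟩⟩ <;> fun_prop

/-- The solution has exponent `1 - μ`, but the common factor in `near_zero` is `x ^ (-μ)`, dictated
by the first derivative; the spare factor `x` goes into `c₀`. The second Kummer parameter `2 - μ` is
positive, so the series is well defined. -/
theorem isRegularKummerSol_of_neg {μ b l : ℝ} (hμ : μ < 0) (hl : 0 < l) :
    ∃ g₁ g₂, IsRegularKummerSol μ (μ - b) l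
      (fun x => (l * x) ^ (1 - μ) * Real.exp (-(l * x)) * kummer (b + 1 - μ) (2 - μ) (l * x))
      g₁ g₂ := by
  rw [kummer_eq_powSum]
  have h2μ : 0 < 2 - μ := by linarith
  have hc := entireCoeff_kummerCoeff (a := b + 1 - μ) h2μ
  have hode := hc.kummer_ode (kummerCoeff_succ (a := b + 1 - μ) h2μ)
  set c := kummerCoeff (b + 1 - μ) (2 - μ)
  have d0 : ∀ x, HasDerivAt (fun x => powSum c (l * x)) (powSum (derivCoeff c) (l * x) * l) x :=
    fun x => (hc.hasDerivAt (l * x)).comp x (hasDerivAt_const_mul l)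
  have d1 : ∀ x, HasDerivAt (fun x => powSum (derivCoeff c) (l * x))
      (powSum (derivCoeff (derivCoeff c)) (l * x) * l) x :=
    fun x => (hc.deriv.hasDerivAt (l * x)).comp x (hasDerivAt_const_mul l)
  have de : ∀ x, HasDerivAt (fun x => Real.exp (-(l * x))) (Real.exp (-(l * x)) * -l) x :=
    fun x => (hasDerivAt_const_mul l).neg.exp
  have dp : ∀ q x : ℝ, 0 < x →
      HasDerivAt (fun x => (l * x) ^ q) (l * q * (l * x) ^ (q - 1)) x := fun q x hx =>
    (hasDerivAt_const_mul l).rpow_const (Or.inl (mul_pos hl hx).ne')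
  have s0 := hc.contDiff
  have k0 := s0.continuous
  have k1 := hc.deriv.contDiff.continuous
  have k2 := hc.deriv.deriv.contDiff.continuous
  have hm : (|μ| - μ) / 2 = -μ := by rw [abs_of_neg hμ]; ring
  have p1 : ∀ x, 0 < x → (l * x) ^ (1 - μ) = (l * x) ^ (-μ) * (l * x) := fun x hx => by
    rw [← Real.rpow_add_one (mul_pos hl hx).ne']; congr 1; ring
  have p2 : ∀ x, 0 < x → (l * x) ^ (1 - μ - 1) = (l * x) ^ (-μ) := fun x hx => by
    congr 1; ring
  refine ⟨fun x => l * (Real.exp (-(l * x)) * ((1 - μ) * (l * x) ^ (-μ) * powSum c (l * x) +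
      (l * x) ^ (1 - μ) * (powSum (derivCoeff c) (l * x) - powSum c (l * x)))),
    fun x => l ^ 2 * (Real.exp (-(l * x)) * ((1 - μ) * -μ * (l * x) ^ (-μ - 1) * powSum c (l * x) +
      2 * (1 - μ) * (l * x) ^ (-μ) * (powSum (derivCoeff c) (l * x) - powSum c (l * x)) +
      (l * x) ^ (1 - μ) * (powSum (derivCoeff (derivCoeff c)) (l * x)
      - 2 * powSum (derivCoeff c) (l * x) + powSum c (l * x)))), ⟨?_, ?_, ?_⟩, ?_, ?_⟩
  · intro x hx
    refine (((dp (1 - μ) x hx).mul (de x)).mul (d0 x)).congr_deriv ?_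
    simp only [Pi.mul_apply]
    rw [p2 x hx]
    ring
  · intro x hx
    have := ((de x).mul ((((dp (-μ) x hx).const_mul (1 - μ)).mul (d0 x)).add
      ((dp (1 - μ) x hx).mul ((d1 x).sub (d0 x))))).const_mul l
    refine this.congr_deriv ?_
    simp only [Pi.mul_apply, Pi.add_apply, Pi.sub_apply]
    rw [p2 x hx]
    ring
  · intro x hx
    rw [p1 x hx, Real.rpow_sub_one (mul_pos hl hx).ne']
    have hlx := (mul_pos hl hx).ne'
    have e : (l * x) ^ (-μ) / (l * x) * x * l = (l * x) ^ (-μ) := by field_simp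
    linear_combination l * Real.exp (-(l * x)) * (l * x) ^ (-μ) * (l * x) * hode (l * x)
      - l * Real.exp (-(l * x)) * (1 - μ) * μ * powSum c (l * x) * e
  · refine ContDiffOn.mul (ContDiffOn.mul (fun x hx => ?_) ?_) ?_
    · exact (ContDiffAt.rpow_const_of_ne (contDiff_const.mul contDiff_id).contDiffAt
        (mul_pos hl hx).ne').contDiffWithinAt
    · exact (Real.contDiff_exp.comp (contDiff_const.mul contDiff_id).neg).contDiffOn
    · exact (s0.comp (contDiff_const.mul contDiff_id)).contDiffOn
  · rw [hm]
    refine ⟨fun x => l ^ (-μ) * ((l * x) * Real.exp (-(l * x)) * powSum c (l * x)),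
      fun x => l ^ (-μ) * (l * (Real.exp (-(l * x)) * ((1 - μ) * powSum c (l * x) +
        (l * x) * (powSum (derivCoeff c) (l * x) - powSum c (l * x))))),
      fun x => l ^ (-μ) * (l * (Real.exp (-(l * x)) * ((1 - μ) * -μ * powSum c (l * x) +
      2 * (1 - μ) * (l * x) * (powSum (derivCoeff c) (l * x) - powSum c (l * x)) +
      (l * x) ^ 2 * (powSum (derivCoeff (derivCoeff c)) (l * x)
      - 2 * powSum (derivCoeff c) (l * x) + powSum c (l * x))))), by fun_prop, by fun_prop, by fun_prop,
      fun x hx => ?_⟩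
    have hlx := (mul_pos hl hx).ne'
    rw [p1 x hx, Real.rpow_sub_one hlx, Real.mul_rpow hl.le hx.le]
    refine ⟨by ring, by ring, ?_⟩
    field_simp

theorem exists_kummer_ne_zero (a l : ℝ) {c : ℝ} (hc : 0 < c) :
    ∃ x, 0 < x ∧ kummer a c (l * x) ≠ 0 := by
  rw [kummer_eq_powSum]
  have h : ContinuousAt (fun x => powSum (kummerCoeff a c) (l * x)) 0 :=
    ((entireCoeff_kummerCoeff hc).contDiff.continuous.comp (continuous_const_mul l)).continuousAt
  have h1 : ∀ᶠ x in 𝓝 (0 : ℝ), powSum (kummerCoeff a c) (l * x) ≠ 0 :=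
    h.eventually_ne (by simp [powSum_kummerCoeff_zero])
  obtain ⟨x, hx, hx0⟩ := ((h1.filter_mono nhdsWithin_le_nhds).and
    (self_mem_nhdsWithin (s := Ioi (0 : ℝ)))).exists
  exact ⟨x, hx0, hx⟩

/-! ### Decay at infinity and finiteness of the norm -/

theorem sqNorm_lt_top_of_bounds {μ R K K' q r : ℝ} {f f₁ f₂ : ℝ → ℝ} (hR : 0 < R) (hq : 0 < q)
    (hr : 0 < r)
    (near : ∀ x, 0 < x → x ≤ R → x ^ (μ + 1) * f₂ x ^ 2 + (x ^ (μ + 1) + x ^ (μ - 1)) * f₁ x ^ 2 +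
      x ^ (μ - 1) * f x ^ 2 ≤ K * x ^ (q - 1))
    (far : ∀ x, R < x → x ^ (μ + 1) * f₂ x ^ 2 + (x ^ (μ + 1) + x ^ (μ - 1)) * f₁ x ^ 2 +
      x ^ (μ - 1) * f x ^ 2 ≤ K' * x ^ (-r - 1)) : sqNorm μ f f₁ f₂ < ⊤ := by
  rw [sqNorm, ← Ioc_union_Ioi_eq_Ioi hR.le]
  refine (lintegral_union_le _ _ _).trans_lt (ENNReal.add_lt_top.2 ⟨?_, ?_⟩)
  · have hi : IntegrableOn (fun x : ℝ => K * x ^ (q - 1)) (Ioc 0 R) :=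
      ((intervalIntegral.intervalIntegrable_rpow' (by linarith : -1 < q - 1)).1).const_mul K
    refine (setLIntegral_mono' measurableSet_Ioc fun x hx => ?_).trans_lt hi.lintegral_lt_top
    exact ENNReal.ofReal_le_ofReal (near x hx.1 hx.2)
  · have hi : IntegrableOn (fun x : ℝ => K' * x ^ (-r - 1)) (Ioi R) :=
      (integrableOn_Ioi_rpow_of_lt (by linarith) hR).const_mul K'
    refine (setLIntegral_mono' measurableSet_Ioi fun x hx => ?_).trans_lt hi.lintegral_lt_top
    exact ENNReal.ofReal_le_ofReal (far x hx)

/-- Solutions of the differential equation decay at infinity like `x ^ (-p)` for every `p < s`. -/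
theorem IsKummerSol.decay {μ s l p : ℝ} {g g₁ g₂ : ℝ → ℝ} (h : IsKummerSol μ s l g g₁ g₂)
    (hl : 0 < l) (hp : p < s) : ∃ R M : ℝ, 0 < R ∧ ∀ x, R ≤ x →
      x ^ (2 * p) * (g x ^ 2 + (x * g₁ x + s * g x) ^ 2) ≤ M := by
  set k := s + 1 - μ with hk
  -- Chosen so that for `y ≥ R` the coefficient `l y - (p + k)` of `w²` dominates the mixed term in
  -- `g w`.
  set R := (|p + k| + (1 - k * s) ^ 2 / (s - p) + 1) / l with hRdef
  have hsp : 0 < s - p := by linarith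
  have hR : 0 < R := by positivity
  have hd : ∀ x, 0 < x → HasDerivAt (fun x => x ^ (2 * p) * (g x ^ 2 + (x * g₁ x + s * g x) ^ 2))
      (x ^ (2 * p) / x * (2 * p * (g x ^ 2 + (x * g₁ x + s * g x) ^ 2) +
        x * (2 * g x * g₁ x + 2 * (x * g₁ x + s * g x) * (g₁ x + x * g₂ x + s * g₁ x)))) x := by
    intro x hx
    have := (Real.hasDerivAt_rpow_const (p := 2 * p) (Or.inl hx.ne')).mul (((h.1 x hx).pow 2).add
      ((((hasDerivAt_id x).mul (h.2 x hx)).add ((h.1 x hx).const_mul s)).pow 2))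
    refine this.congr_deriv ?_
    simp only [Pi.add_apply, Pi.mul_apply, Pi.pow_apply, id]
    rw [Real.rpow_sub_one hx.ne']
    field_simp
    norm_num
    ring
  refine ⟨R, R ^ (2 * p) * (g R ^ 2 + (R * g₁ R + s * g R) ^ 2), hR, fun x hx => ?_⟩
  have hanti : AntitoneOn (fun x => x ^ (2 * p) * (g x ^ 2 + (x * g₁ x + s * g x) ^ 2)) (Ici R) := by
    refine antitoneOn_of_hasDerivWithinAt_nonpos (convex_Ici R)
      (fun y hy => (hd y (hR.trans_le hy)).continuousAt.continuousWithinAt)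
      (fun y hy => (hd y (hR.trans_le (interior_subset hy))).hasDerivWithinAt) fun y hy => ?_
    have hyR : R ≤ y := interior_subset hy
    have hy0 : 0 < y := hR.trans_le hyR
    refine mul_nonpos_of_nonneg_of_nonpos (by positivity) ?_
    -- By the differential equation `y w' = k (w - s g) - l y w`, so `w` is strongly damped; since
    -- `y g' = w - s g`, the function `g` behaves like `y ^ (-s)`.
    set w := y * g₁ y + s * g y with hw
    have e1 : y * (g₁ y + y * g₂ y + s * g₁ y) = k * (w - s * g y) - l * y * w := by
      rw [hw, hk]; linear_combination y * h.3 y hy0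
    have e2 : 2 * p * (g y ^ 2 + w ^ 2) + y * (2 * g y * g₁ y + 2 * w * (g₁ y + y * g₂ y + s * g₁ y))
        = -(2 * (s - p) * g y ^ 2 - 2 * (1 - k * s) * g y * w + 2 * (l * y - (p + k)) * w ^ 2) := by
      linear_combination 2 * w * e1 - 2 * g y * hw
    have e3 : (1 - k * s) ^ 2 / (s - p) ≤ l * y - (p + k) := by
      have h1 : l * R = |p + k| + (1 - k * s) ^ 2 / (s - p) + 1 := by rw [hRdef]; field_simp
      have h2 : l * R ≤ l * y := mul_le_mul_of_nonneg_left hyR hl.le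
      linarith [le_abs_self (p + k)]
    rw [e2, neg_nonpos]
    have e4 : (s - p) * (2 * (s - p) * g y ^ 2 - 2 * (1 - k * s) * g y * w
        + 2 * ((1 - k * s) ^ 2 / (s - p)) * w ^ 2) =
        ((s - p) * g y - (1 - k * s) * w) ^ 2 + ((s - p) * g y) ^ 2 + ((1 - k * s) * w) ^ 2 := by
      field_simp; ring
    have e5 : 0 ≤ 2 * (s - p) * g y ^ 2 - 2 * (1 - k * s) * g y * w
        + 2 * ((1 - k * s) ^ 2 / (s - p)) * w ^ 2 :=
      nonneg_of_mul_nonneg_right (e4 ▸ by positivity) hsp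
    nlinarith [mul_le_mul_of_nonneg_right e3 (sq_nonneg w)]
  exact hanti self_mem_Ici hx hx

/-- The integrand is `O(x ^ (|μ| - 1))` at `0`, integrable since `μ ≠ 0`, and `O(x ^ (μ - 1 - 2p))`
at infinity, integrable once `p > μ / 2`; a `p` between `μ / 2` and `s` serves both the
integrability and the decay. -/
theorem IsRegularKummerSol.memE {μ s l : ℝ} {g g₁ g₂ : ℝ → ℝ}
    (h : IsRegularKummerSol μ s l g g₁ g₂) (hμ : μ ≠ 0) (hl : 0 < l) (hs : μ / 2 < s) :
    MemE μ g := by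
  refine ⟨h.contDiffOn, ?_⟩
  have hk := h.toIsKummerSol
  have hd1 : ∀ x, 0 < x → deriv g x = g₁ x := fun x hx => (hk.1 x hx).deriv
  have hd2 : ∀ x, 0 < x → deriv (deriv g) x = g₂ x := fun x hx => by
    refine ((hk.2 x hx).congr_of_eventuallyEq ?_).deriv
    filter_upwards [Ioi_mem_nhds hx] with y hy using hd1 y hy
  obtain ⟨p, hp1, hp2⟩ := exists_between hs
  obtain ⟨R, M, hR, hM⟩ := hk.decay hl hp2
  obtain ⟨c₀, c₁, c₂, k0, k1, k2, hc⟩ := h.near_zero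
  have hcont : Continuous fun x => c₂ x ^ 2 + x ^ 2 * c₁ x ^ 2 + c₁ x ^ 2 + c₀ x ^ 2 := by fun_prop
  obtain ⟨K, hK⟩ := (isCompact_Icc (a := 0) (b := R)).exists_bound_of_continuousOn hcont.continuousOn
  have factor : ∀ x, 0 < x → x ^ (μ + 1) * (deriv (deriv g) x) ^ 2
      + (x ^ (μ + 1) + x ^ (μ - 1)) * (deriv g x) ^ 2 + x ^ (μ - 1) * g x ^ 2 =
      x ^ (μ - 1) * ((x * g₂ x) ^ 2 + (x * g₁ x) ^ 2 + g₁ x ^ 2 + g x ^ 2) := by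
    intro x hx
    rw [hd1 x hx, hd2 x hx, show μ + 1 = μ - 1 + 2 by ring, Real.rpow_add hx, Real.rpow_two]
    ring
  -- The sum of the constants in `b3`, `b1`, `b2`, `b0`.
  set T := (l + |μ| / R) ^ 2 * 2 * (2 * (1 + s ^ 2)) + 2 * (l * s) ^ 2 + 2 * (1 + s ^ 2)
    + 2 * (1 + s ^ 2) / R ^ 2 + 1 with hT
  refine sqNorm_lt_top_of_bounds (q := |μ|) (r := 2 * p - μ) (K := K) (K' := T * M) hR
    (abs_pos.2 hμ) (by linarith) (fun x hx hxR => ?_) (fun x hx => ?_)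
  · obtain ⟨e0, e1, e2⟩ := hc x hx
    rw [factor x hx, e2, e0, mul_pow x, e1]
    have hb := (le_abs_self _).trans (hK x ⟨hx.le, hxR⟩)
    have e : x ^ (|μ| - 1) = x ^ (μ - 1) * (x ^ ((|μ| - μ) / 2)) ^ 2 := by
      rw [← Real.rpow_two, ← Real.rpow_mul hx.le, ← Real.rpow_add hx]; congr 1; ring
    rw [e]
    calc _ = (c₂ x ^ 2 + x ^ 2 * c₁ x ^ 2 + c₁ x ^ 2 + c₀ x ^ 2) *
          (x ^ (μ - 1) * (x ^ ((|μ| - μ) / 2)) ^ 2) := by ring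
      _ ≤ _ := by
        have := Real.rpow_pos_of_pos hx (μ - 1)
        gcongr
  · have hx0 : 0 < x := hR.trans hx
    rw [factor x hx0]
    have hE := hM x hx.le
    set w := x * g₁ x + s * g x with hw
    have hEn : 0 ≤ g x ^ 2 + w ^ 2 := by positivity
    have b1 : (x * g₁ x) ^ 2 ≤ 2 * (1 + s ^ 2) * (g x ^ 2 + w ^ 2) := by
      have : x * g₁ x = w - s * g x := by rw [hw]; ring
      rw [this]
      nlinarith [sq_nonneg (w + s * g x), sq_nonneg (s * w), sq_nonneg (g x)]
    have b0 : g x ^ 2 ≤ g x ^ 2 + w ^ 2 := by linarith [sq_nonneg w]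
    have b2 : g₁ x ^ 2 ≤ 2 * (1 + s ^ 2) / R ^ 2 * (g x ^ 2 + w ^ 2) := by
      rw [div_mul_eq_mul_div, le_div_iff₀ (by positivity)]
      refine le_trans ?_ b1
      rw [mul_pow, mul_comm]
      gcongr
    have b3 : (x * g₂ x) ^ 2 ≤ ((l + |μ| / R) ^ 2 * 2 * (2 * (1 + s ^ 2)) + 2 * (l * s) ^ 2)
        * (g x ^ 2 + w ^ 2) := by
      have e : x * g₂ x = -((l + μ / x) * (x * g₁ x) + l * s * g x) := by
        field_simp
        linear_combination h.ode x hx0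
      have e2 : (l + μ / x) ^ 2 ≤ (l + |μ| / R) ^ 2 := by
        refine sq_le_sq' ?_ ?_
        · have : -(|μ| / R) ≤ μ / x := by
            rw [neg_le, ← neg_div]
            exact div_le_div₀ (abs_nonneg _) (neg_le_abs μ) hR hx.le
          linarith
        · have : μ / x ≤ |μ| / R := div_le_div₀ (abs_nonneg _) (le_abs_self μ) hR hx.le
          linarith
      rw [e]
      calc _ ≤ 2 * ((l + μ / x) ^ 2 * (x * g₁ x) ^ 2) + 2 * (l * s) ^ 2 * g x ^ 2 := by
            nlinarith [sq_nonneg ((l + μ / x) * (x * g₁ x) - l * s * g x)]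
        _ ≤ 2 * ((l + |μ| / R) ^ 2 * (2 * (1 + s ^ 2) * (g x ^ 2 + w ^ 2)))
            + 2 * (l * s) ^ 2 * (g x ^ 2 + w ^ 2) := by gcongr
        _ = _ := by ring
    have b : (x * g₂ x) ^ 2 + (x * g₁ x) ^ 2 + g₁ x ^ 2 + g x ^ 2 ≤ T * (g x ^ 2 + w ^ 2) := by
      rw [hT]; linarith
    have e : x ^ (-(2 * p - μ) - 1) = x ^ (μ - 1) * (x ^ (2 * p))⁻¹ := by
      rw [← Real.rpow_neg hx0.le, ← Real.rpow_add hx0]; congr 1; ring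
    have hT0 : 0 ≤ T := by positivity
    have hp0 := Real.rpow_pos_of_pos hx0 (2 * p)
    have hE' : g x ^ 2 + w ^ 2 ≤ M * (x ^ (2 * p))⁻¹ := by
      rw [← div_eq_mul_inv, le_div_iff₀ hp0]; linarith
    have := Real.rpow_pos_of_pos hx0 (μ - 1)
    rw [e]
    calc _ ≤ x ^ (μ - 1) * (T * (M * (x ^ (2 * p))⁻¹)) := by
          gcongr
          exact b.trans (mul_le_mul_of_nonneg_left hE' hT0)
      _ = _ := by ring

/-! ### The case of equality -/

theorem JetMemLp.congr {μ : ℝ} {f f₁ f₂ F G H : ℝ → ℝ} (J : JetMemLp μ f f₁ f₂)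
    (e : f =ᵐ[volPos] F) (e₁ : f₁ =ᵐ[volPos] G) (e₂ : f₂ =ᵐ[volPos] H) : JetMemLp μ F G H := by
  have aux : ∀ {r : ℝ} {u v : ℝ → ℝ}, u =ᵐ[volPos] v → wt r u =ᵐ[volPos] wt r v := by
    intro r u v h
    filter_upwards [h] with x hx
    simp only [wt, hx]
  exact ⟨(memLp_congr_ae (aux e₂)).1 J.memX, (memLp_congr_ae (aux e₁)).1 J.memY,
    (memLp_congr_ae (aux e₁)).1 J.memZ, (memLp_congr_ae (aux e)).1 J.memW⟩

/-- Elements of the completion that satisfy the differential equation almost everywhere are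
multiples of the regular solution. -/
theorem MemEbar.ae_eq_const_mul {μ s l : ℝ} {f f₁ f₂ g g₁ g₂ : ℝ → ℝ} (h : MemEbar μ f f₁ f₂)
    (hg : IsRegularKummerSol μ s l g g₁ g₂) {x₀ : ℝ} (hx₀ : 0 < x₀) (hgx₀ : g x₀ ≠ 0)
    (hode : ∀ᵐ x ∂volPos, x * f₂ x + (l * x + μ) * f₁ x + l * s * f x = 0) :
    ∃ C, ∀ᵐ x ∂volPos, f x = C * g x := by
  obtain ⟨F, G, hF, cG, hG, eF, eG⟩ := h.exists_representative
  -- The second derivative as prescribed by the equation; it is continuous, so `G` becomes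
  -- classically differentiable.
  set H : ℝ → ℝ := fun x => -((l * x + μ) * G x + l * s * F x) / x with hH
  have cF : ContinuousOn F (Ioi 0) := fun x hx => (hF x hx).continuousAt.continuousWithinAt
  have cH : ContinuousOn H (Ioi 0) := by
    refine ContinuousOn.div ?_ continuousOn_id fun x hx => ne_of_gt hx
    fun_prop
  have eH : f₂ =ᵐ[volPos] H := by
    filter_upwards [eF, eG, hode, ae_restrict_mem measurableSet_Ioi] with x h1 h2 h3 hx
    rw [hH, eq_div_iff (ne_of_gt hx)]
    rw [h1, h2] at h3
    linear_combination h3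
  have hG' : ∀ x, 0 < x → HasDerivAt G (H x) x := fun x hx =>
    hasDerivAt_of_integral (fun y z hy hz => by
      rw [hG y z hy hz]
      refine intervalIntegral.integral_congr_ae ?_
      filter_upwards [(ae_restrict_iff' measurableSet_Ioi).1 eH] with t ht ht'
      exact ht ((lt_min hy hz).trans ht'.1)) cH hx
  have sol : IsKummerSol μ s l F G H := ⟨hF, hG', fun x hx => by
    rw [hH]; field_simp; ring⟩
  obtain ⟨-, tF, tG⟩ := (h.jetMemLp.congr eF eG eH).identities hF hG'
  obtain ⟨c₀, c₁, c₂, k0, k1, -, hc⟩ := hg.near_zero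
  obtain ⟨K, hK⟩ := (isCompact_Icc (a := (0 : ℝ)) (b := 1)).exists_bound_of_continuousOn
    (f := fun x => |c₀ x| + |c₁ x|) (by fun_prop)
  have hW := sol.wronskian_eq_zero hg.toIsKummerSol (K := K) (m := (|μ| - μ) / 2) tF tG
    (fun x hx hx1 => ?_) (fun x hx hx1 => ?_) (by linarith [abs_nonneg μ]) hx₀
  · obtain ⟨C, hC⟩ := sol.eq_const_mul hg.toIsKummerSol hx₀ hgx₀ hW
    refine ⟨C, ?_⟩
    filter_upwards [eF, ae_restrict_mem measurableSet_Ioi] with x h1 hx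
    rw [h1, hC x hx]
  all_goals
    obtain ⟨e0, e1, -⟩ := hc x hx
    have hb := (le_abs_self _).trans (hK x ⟨hx.le, hx1⟩)
    have hp := Real.rpow_pos_of_pos hx ((|μ| - μ) / 2)
  · rw [e0, abs_mul, abs_of_pos hp, mul_comm]
    gcongr
    linarith [abs_nonneg (c₁ x)]
  · rw [e1, abs_mul, abs_of_pos hp, mul_comm]
    gcongr
    linarith [abs_nonneg (c₀ x)]

theorem wt_kummer_operator {μ s l x : ℝ} (f f₁ f₂ : ℝ → ℝ) (hx : 0 < x) :
    wt (μ + 1) f₂ x + l * wt (μ + 1) f₁ x + μ * wt (μ - 1) f₁ x + l * s * wt (μ - 1) f x =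
      x ^ ((μ - 1) / 2) * (x * f₂ x + (l * x + μ) * f₁ x + l * s * f x) := by
  simp only [wt]
  rw [show (μ + 1) / 2 = (μ - 1) / 2 + 1 by ring, Real.rpow_add_one hx.ne']
  ring

theorem ae_eq_zero_of_integral_mul_self {W : ℝ → ℝ} {ν : Measure ℝ} (hW : MemLp W 2 ν)
    (h : ∫ x, W x * W x ∂ν = 0) : W =ᵐ[ν] 0 := by
  rw [integral_eq_zero_iff_of_nonneg (fun x => mul_self_nonneg _) (hW.integrable_mul hW)] at h
  filter_upwards [h] with x hx
  exact mul_self_eq_zero.1 hx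

/-- The case of equality in the inequality between the coefficients of a nonnegative quadratic
polynomial. -/
theorem eq_of_quadratic_nonneg {A B D k l : ℝ} (hl : l ≠ 0)
    (h : ∀ t : ℝ, 0 ≤ A + t ^ 2 * B - t * k * D) (h0 : A + l ^ 2 * B - l * k * D = 0) :
    A * B = 1 / 4 * k ^ 2 * D ^ 2 := by
  have h1 : discrim B (-(k * D)) A ≤ 0 := discrim_le_zero fun t => by linarith [h t]
  rw [discrim] at h1
  -- By `h0`, `l k D = A + l² B`, so the right side equals `(A - l² B)²`; no sign of `B` is needed.
  have h2 : 0 ≤ l ^ 2 * ((k * D) ^ 2 - 4 * A * B) := by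
    nlinarith [sq_nonneg (A - l ^ 2 * B), congrArg (fun z => z ^ 2) (sub_eq_zero.1 h0)]
  have h3 := nonneg_of_mul_nonneg_right h2 (by positivity)
  linarith

/-- Equality says that the discriminant of the nonnegative polynomial `A + t² B - t k D` vanishes;
its root at a positive `l` is the same as `f` solving the differential equation for that `l`. -/
theorem MemEbar.interpolationEquality_iff {μ ε s : ℝ} {f f₁ f₂ : ℝ → ℝ} (h : MemEbar μ f f₁ f₂)
    (hμ : μ ≠ 0) (hs : (μ - s) * s = ε) (hs' : 2 * s - μ = Real.sqrt (μ ^ 2 - 4 * ε))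
    {g : ℝ → ℝ → ℝ} (hg : ∀ l, 0 < l → ∃ g₁ g₂, IsRegularKummerSol μ s l (g l) g₁ g₂)
    (hg0 : ∀ l, 0 < l → ∃ x, 0 < x ∧ g l x ≠ 0) :
    InterpolationEquality μ ε f f₁ f₂ ↔
      ∃ C l : ℝ, 0 < l ∧ ∀ᵐ x ∂(volume.restrict (Ioi (0 : ℝ))), f x = C * g l x := by
  have J := h.jetMemLp
  have I := h.jetIdentities
  set A := ∫ x in Ioi (0 : ℝ), wt (μ + 1) f₂ x * wt (μ + 1) f₂ x with hA
  set BY := ∫ x in Ioi (0 : ℝ), wt (μ + 1) f₁ x * wt (μ + 1) f₁ x with hBY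
  set BW := ∫ x in Ioi (0 : ℝ), wt (μ - 1) f x * wt (μ - 1) f x with hBW
  set D := ∫ x in Ioi (0 : ℝ), wt (μ + 1) f₁ x * wt (μ - 1) f₁ x with hD
  set k := Real.sqrt (μ ^ 2 - 4 * ε) + 1 with hk
  have iYY : Integrable (fun x => wt (μ + 1) f₁ x * wt (μ + 1) f₁ x) volPos :=
    J.memY.integrable_mul J.memY
  have iWW : Integrable (fun x => wt (μ - 1) f x * wt (μ - 1) f x) volPos :=
    J.memW.integrable_mul J.memW
  have iYZ : Integrable (fun x => wt (μ + 1) f₁ x * wt (μ - 1) f₁ x) volPos :=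
    J.memY.integrable_mul J.memZ
  have hIE : InterpolationEquality μ ε f f₁ f₂ ↔ A * (BY - ε * BW) = 1 / 4 * k ^ 2 * D ^ 2 := by
    have e1 : (∫ x in Ioi (0 : ℝ), f₂ x ^ 2 * x ^ (μ + 1)) = A :=
      setIntegral_congr_fun measurableSet_Ioi fun x hx => by
        rw [wt_mul_wt (q := μ + 1) (by ring) _ _ hx]; ring
    have e2 : (∫ x in Ioi (0 : ℝ), (x ^ 2 * f₁ x ^ 2 - ε * f x ^ 2) * x ^ (μ - 1)) =
        BY - ε * BW := by
      rw [hBY, hBW, ← integral_const_mul, ← integral_sub iYY (iWW.const_mul ε)]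
      refine setIntegral_congr_fun measurableSet_Ioi fun x hx => ?_
      rw [wt_mul_wt (q := μ + 1) (by ring) _ _ hx, wt_mul_wt (q := μ - 1) (by ring) _ _ hx,
        show μ + 1 = μ - 1 + 2 by ring, Real.rpow_add hx, Real.rpow_two]
      ring
    have e3 : (∫ x in Ioi (0 : ℝ), f₁ x ^ 2 * x ^ μ) = D :=
      setIntegral_congr_fun measurableSet_Ioi fun x hx => by
        rw [wt_mul_wt (q := μ) (by ring) _ _ hx]; ring
    rw [InterpolationEquality, e1, e2, e3]
  set B := BY - ε * BW with hB
  have hk1 : 0 < k := by positivity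
  have hA0 : 0 ≤ A := integral_nonneg fun x => mul_self_nonneg _
  have hYZ0 : 0 ≤ᵐ[volPos] fun x => wt (μ + 1) f₁ x * wt (μ - 1) f₁ x := by
    filter_upwards [ae_restrict_mem measurableSet_Ioi] with x hx
    have hx : 0 < x := hx
    simp only [wt]
    rw [show x ^ ((μ + 1) / 2) * f₁ x * (x ^ ((μ - 1) / 2) * f₁ x) =
      x ^ ((μ + 1) / 2) * x ^ ((μ - 1) / 2) * (f₁ x * f₁ x) by ring]
    exact mul_nonneg (by positivity) (mul_self_nonneg _)
  have hD0 : 0 ≤ D := integral_nonneg_of_ae hYZ0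
  have hQ : ∀ t : ℝ, ∫ x in Ioi (0 : ℝ), (wt (μ + 1) f₂ x + t * wt (μ + 1) f₁ x
      + μ * wt (μ - 1) f₁ x + t * s * wt (μ - 1) f x) ^ 2 = A + t ^ 2 * B - t * k * D := by
    intro t
    rw [I.integral_sq J s t, hs, hs']
  rw [hIE]
  constructor
  · intro heq
    -- If `D = 0`, then `f₁ = 0`, and the identity `yw` together with `μ ≠ 0` forces `f = 0`, so `C
    -- = 0` works.
    rcases hD0.eq_or_lt with hD1 | hD1
    · refine ⟨0, 1, one_pos, ?_⟩
      have e1 : f₁ =ᵐ[volPos] 0 := by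
        have := (integral_eq_zero_iff_of_nonneg_ae hYZ0 iYZ).1 hD1.symm
        filter_upwards [this, ae_restrict_mem measurableSet_Ioi] with x h1 hx
        have hx : 0 < x := hx
        simp only [wt, Pi.zero_apply, mul_eq_zero, (Real.rpow_pos_of_pos hx _).ne', false_or,
          or_self] at h1
        exact h1
      have e2 : BW = 0 := by
        have h1 := I.yw
        have h2 : ∫ x in Ioi (0 : ℝ), wt (μ + 1) f₁ x * wt (μ - 1) f x = 0 :=
          integral_eq_zero_of_ae (by filter_upwards [e1] with x hx; simp [wt, hx])
        rw [h2, mul_zero, ← hBW] at h1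
        simpa [hμ] using h1.symm
      filter_upwards [ae_eq_zero_of_integral_mul_self J.memW e2,
        ae_restrict_mem measurableSet_Ioi] with x h1 hx
      have hx : 0 < x := hx
      simp only [wt, Pi.zero_apply, mul_eq_zero, (Real.rpow_pos_of_pos hx _).ne', false_or] at h1
      simp [h1]
    · have hAB : 0 < A * B := by rw [heq]; positivity
      have hB1 : 0 < B := by
        by_contra hn
        exact hAB.not_ge (mul_nonpos_of_nonneg_of_nonpos hA0 (not_lt.1 hn))
      -- The vertex of the parabola, which is its double root in the case of equality.
      set l := k * D / (2 * B) with hl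
      have hl0 : 0 < l := by positivity
      have hQl : A + l ^ 2 * B - l * k * D = 0 := by
        have : B * (A + l ^ 2 * B - l * k * D) = 0 := by
          rw [hl]; field_simp; linear_combination 4 * heq
        exact (mul_eq_zero.1 this).resolve_left hB1.ne'
      obtain ⟨g₁, g₂, hreg⟩ := hg l hl0
      obtain ⟨x₀, hx₀, hne⟩ := hg0 l hl0
      have hL : MemLp (fun x => wt (μ + 1) f₂ x + l * wt (μ + 1) f₁ x
          + μ * wt (μ - 1) f₁ x + l * s * wt (μ - 1) f x) 2 volPos :=
        ((J.memX.add (J.memY.const_mul l)).add (J.memZ.const_mul μ)).add (J.memW.const_mul (l * s))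
      have hz := ae_eq_zero_of_integral_mul_self hL (by
        have := hQ l
        rw [hQl] at this
        simpa only [pow_two] using this)
      obtain ⟨C, hC⟩ := h.ae_eq_const_mul hreg hx₀ hne (by
        filter_upwards [hz, ae_restrict_mem measurableSet_Ioi] with x h1 hx
        rw [wt_kummer_operator f f₁ f₂ hx] at h1
        exact (mul_eq_zero.1 h1).resolve_left (Real.rpow_pos_of_pos hx _).ne')
      exact ⟨C, l, hl0, hC⟩
  · rintro ⟨C, l, hl, hf⟩
    obtain ⟨g₁, g₂, hreg⟩ := hg l hl
    have hsol := hreg.toIsKummerSol.const_mul C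
    obtain ⟨e1, e2⟩ := h.ae_eq_derivatives hsol.hasDerivAt hsol.hasDerivAt₁ hf
    refine eq_of_quadratic_nonneg hl.ne' (fun t => ?_) ?_
    · rw [← hQ t]; exact integral_nonneg fun x => sq_nonneg _
    · rw [← hQ l]
      refine integral_eq_zero_of_ae ?_
      filter_upwards [hf, e1, e2, ae_restrict_mem measurableSet_Ioi] with x h0 h1 h2 hx
      rw [wt_kummer_operator f f₁ f₂ hx, h0, h1, h2, hsol.ode x hx]
      simp

theorem corollary2 (μ ε b : ℝ) (hμ : μ ≠ 0) (hε : ε ≤ μ ^ 2 / 4)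
    (hb : b = (μ - Real.sqrt (μ ^ 2 - 4 * ε)) / 2) :
    -- characterisation of the extremisers
    (∀ f f₁ f₂ : ℝ → ℝ, MemEbar μ f f₁ f₂ →
      (0 < μ → (InterpolationEquality μ ε f f₁ f₂ ↔
        ∃ C l : ℝ, 0 < l ∧ ∀ᵐ x ∂(volume.restrict (Ioi (0 : ℝ))),
          f x = C * Real.exp (-(l * x)) * kummer b μ (l * x))) ∧
      (μ < 0 → (InterpolationEquality μ ε f f₁ f₂ ↔
        ∃ C l : ℝ, 0 < l ∧ ∀ᵐ x ∂(volume.restrict (Ioi (0 : ℝ))),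
          f x = C * (l * x) ^ (1 - μ) * Real.exp (-(l * x)) *
            kummer (b + 1 - μ) (2 - μ) (l * x)))) ∧
    -- away from the borderline value of `ε` these functions do lie in the space
    (ε < μ ^ 2 / 4 → ∀ C l : ℝ, 0 < l →
      (0 < μ → MemE μ (fun x => C * Real.exp (-(l * x)) * kummer b μ (l * x))) ∧
      (μ < 0 → MemE μ (fun x => C * (l * x) ^ (1 - μ) * Real.exp (-(l * x)) *
        kummer (b + 1 - μ) (2 - μ) (l * x)))) := by
  have hr : 0 ≤ μ ^ 2 - 4 * ε := by linarith
  have hsq := Real.sq_sqrt hr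
  -- Here `s = μ - b`, the larger of the two roots.
  have hs' : 2 * (μ - b) - μ = Real.sqrt (μ ^ 2 - 4 * ε) := by rw [hb]; ring
  have hs : (μ - (μ - b)) * (μ - b) = ε := by
    rw [hb]
    linear_combination -hsq / 4
  have epos : ∀ C l : ℝ, (fun x => C * Real.exp (-(l * x)) * kummer b μ (l * x)) =
      fun x => C * (Real.exp (-(l * x)) * kummer b μ (l * x)) := fun C l => by
    funext x; ring
  have eneg : ∀ C l : ℝ, (fun x => C * (l * x) ^ (1 - μ) * Real.exp (-(l * x)) *
        kummer (b + 1 - μ) (2 - μ) (l * x)) = fun x => C * ((l * x) ^ (1 - μ) *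
        Real.exp (-(l * x)) * kummer (b + 1 - μ) (2 - μ) (l * x)) := fun C l => by
    funext x; ring
  refine ⟨fun f f₁ f₂ h => ⟨fun hμ0 => ?_, fun hμ0 => ?_⟩, fun hε' C l hl => ?_⟩
  · simp_rw [fun C l : ℝ => funext_iff.1 (epos C l)]
    refine h.interpolationEquality_iff hμ hs hs'
      (g := fun l x => Real.exp (-(l * x)) * kummer b μ (l * x))
      (fun l _ => isRegularKummerSol_of_pos hμ0) fun l _ => ?_
    obtain ⟨x, hx, hne⟩ := exists_kummer_ne_zero b l hμ0
    exact ⟨x, hx, mul_ne_zero (Real.exp_pos _).ne' hne⟩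
  · simp_rw [fun C l : ℝ => funext_iff.1 (eneg C l)]
    refine h.interpolationEquality_iff hμ hs hs'
      (g := fun l x => (l * x) ^ (1 - μ) * Real.exp (-(l * x)) *
        kummer (b + 1 - μ) (2 - μ) (l * x))
      (fun l hl => isRegularKummerSol_of_neg hμ0 hl) fun l hl => ?_
    obtain ⟨x, hx, hne⟩ := exists_kummer_ne_zero (b + 1 - μ) l (c := 2 - μ) (by linarith)
    exact ⟨x, hx, mul_ne_zero (mul_ne_zero (Real.rpow_pos_of_pos (mul_pos hl hx) _).ne'
      (Real.exp_pos _).ne') hne⟩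
  · have hpos : 0 < Real.sqrt (μ ^ 2 - 4 * ε) := Real.sqrt_pos.2 (by linarith)
    -- The only place for strictness of `ε < μ² / 4`: at the borderline `s = μ / 2`, and no
    -- admissible `p` is left.
    have hsμ : μ / 2 < μ - b := by linarith
    refine ⟨fun hμ0 => ?_, fun hμ0 => ?_⟩
    · obtain ⟨g₁, g₂, hreg⟩ := isRegularKummerSol_of_pos (b := b) (l := l) hμ0
      rw [epos]
      exact (hreg.const_mul C).memE hμ hl hsμ
    · obtain ⟨g₁, g₂, hreg⟩ := isRegularKummerSol_of_neg (b := b) hμ0 hl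
      rw [eneg]
      exact (hreg.const_mul C).memE hμ hl hsμ
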